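/- Let $D,N,M\ge 1$ be integers, $\sigma\ge 0$, and let $\gamma^\natural\in\mathbb{R}^N$ be a non-zero vector with non-negative entries. Put $S^\natural=\{k:\gamma^\natural_k\neq 0\}$, $K=|S^\natural|$, $\gamma_{\min}=\min_{k\in S^\natural}\gamma^\natural_k$, $\gamma_{\max}=\max_{k\in S^\natural}\gamma^\natural_k$ and $c_\gamma=\gamma_{\max}/\gamma_{\min}$. Let $a_1,\dots,a_N$ be i.i.d. random vectors, uniform on the sphere of radius $\sqrt D$ in $\mathbb{C}^D$, let $H\in\mathbb{C}^{N\times M}$ have i.i.d. $\mathcal{CN}(0,1)$ entries and $Z\in\mathbb{C}^{D\times M}$ i.i.d. $\mathcal{CN}(0,\sigma^2)$ entries, with $(a_k)_k$, $H$, $Z$ independent. With $A=[a_1,\dots,a_N]$ and $\Gamma^\natural=\mathrm{diag}(\gamma^\natural)$ let $$Y=A\sqrt{\Gamma^\natural}\,H+Z,\qquad \widehat\Sigma_y=\tfrac1M YY^*,\qquad \mathcal{Y}_k=\sum_{i,j=1}^D\overline{a_{k,i}}\,a_{k,j}\,\widehat\Sigma_y(i,j)\quad(k=1,\dots,N).$$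 Let $\hat S$ be the set of the indices of the $K$ largest $\mathcal{Y}_k$. Let $\gamma_1=\mathcal{H}_K\big(\tfrac1{D^2}\mathcal{A}^*u\big)$ be the output of one step of iterative hard thresholding started at $0$, where $\mathcal{A}\in\mathbb{C}^{D^2\times N}$ has the columns $\mathrm{vec}(a_ka_k^*)$, $u=\mathrm{vec}(\widehat\Sigma_y-\sigma^2I_D)$, and $\mathcal{H}_K$ keeps the $K$ entries of largest magnitude and sets the others to $0$. Ties in the choice of $\hat S$ and in $\mathcal{H}_K$ may be broken in any way. There are universal constants $c_0,c_4,c_5>0$ such that, for every $\varepsilon>0$, if $$M\ge c_4\Big(c_\gamma K+\frac{\sigma^2}{\gamma_{\min}}\Big)^2\log\frac{(eD)^2}{\varepsilon}\qquad\text{and}\qquad K\le c_5\frac{D}{c_\gamma\log(ND)},$$ then $$\mathbb{P}\big(\hat S=S^\natural\big)\ge 1-\varepsilon-\frac{c_0}{D\sqrt D},$$ and moreover, with the same bound, $\hat S$ coincides with the support returned by one-step iterative hard thresholding: $$\mathbb{P}\big(\hat S=\mathrm{supp}(\gamma_1)=S^\natural\big)\ge 1-\varepsilon-\frac{c_0}{D\sqrt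 D}.$$ (The second condition is read as void if $ND=1$.) -/

import Mathlib

open MeasureTheory ProbabilityTheory
open scoped NNReal ENNReal Matrix ComplexConjugate

namespace URA

noncomputable section

/-- The uniform probability distribution on the sphere of radius `√D` in `ℂ^D`: the surface measure
of the unit sphere, normalized to mass one and pushed forward under `x ↦ √D • x`. -/
def sphereUniform (D : ℕ) : Measure (EuclideanSpace ℂ (Fin D)) :=
  (((volume : Measure (EuclideanSpace ℂ (Fin D))).toSphere Set.univ)⁻¹ •
    (volume : Measure (EuclideanSpace ℂ (Fin D))).toSphere).map
      (fun x : Metric.sphere (0 : EuclideanSpace ℂ (Fin D)) 1 =>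
        (√(D : ℝ)) • (x : EuclideanSpace ℂ (Fin D)))

/-- The circularly symmetric complex Gaussian law `𝒞𝒩(0, v)`: independent real and imaginary
parts, each of law `𝒩(0, v / 2)`. -/
def complexGaussian (v : ℝ≥0) : Measure ℂ :=
  ((gaussianReal 0 (v / 2)).prod (gaussianReal 0 (v / 2))).map
    (fun p : ℝ × ℝ => (⟨p.1, p.2⟩ : ℂ))

/-- The random ingredients of the channel with `D` channel uses, `N` codewords and `M` antennas:
codewords `a k` i.i.d. uniform on the sphere of radius `√D`, fading coefficients `H k j` i.i.d.
`𝒞𝒩(0, 1)`, noise entries `Z i j` i.i.d. `𝒞𝒩(0, σ²)`, all of them mutually independent. -/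
structure IsChannel {Ω : Type*} [MeasurableSpace Ω] (μ : Measure Ω) {D N M : ℕ} (σ : ℝ≥0)
    (a : Fin N → Ω → EuclideanSpace ℂ (Fin D)) (H : Fin N → Fin M → Ω → ℂ)
    (Z : Fin D → Fin M → Ω → ℂ) : Prop where
  law_codeword : ∀ k, HasLaw (a k) (sphereUniform D) μ
  law_fading : ∀ k j, HasLaw (H k j) (complexGaussian 1) μ
  law_noise : ∀ i j, HasLaw (Z i j) (complexGaussian (σ ^ 2)) μ
  indep_codewords : iIndepFun a μ
  indep_fading : iIndepFun (fun p : Fin N × Fin M => H p.1 p.2) μ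
  indep_noise : iIndepFun (fun p : Fin D × Fin M => Z p.1 p.2) μ
  indep_fading_noise : IndepFun (fun ω k j => H k j ω) (fun ω i j => Z i j ω) μ
  indep_codewords_channel : IndepFun (fun ω k => a k ω)
    (fun ω => ((fun k j => H k j ω : Fin N → Fin M → ℂ), (fun i j => Z i j ω : Fin D → Fin M → ℂ))) μ

/-- The codebook matrix, whose `k`-th column is `a k`. -/
def codebook {D N : ℕ} (a : Fin N → EuclideanSpace ℂ (Fin D)) : Matrix (Fin D) (Fin N) ℂ :=
  Matrix.of fun i k => a k i

/-- The received signal `Y = A √Γ H + Z`, where `Γ = diag γ`. -/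
def received {D N M : ℕ} (a : Fin N → EuclideanSpace ℂ (Fin D)) (γ : Fin N → ℝ)
    (H : Matrix (Fin N) (Fin M) ℂ) (Z : Matrix (Fin D) (Fin M) ℂ) : Matrix (Fin D) (Fin M) ℂ :=
  codebook a * Matrix.diagonal (fun k => ((√(γ k) : ℝ) : ℂ)) * H + Z

/-- The sample covariance matrix `(1 / M) Y Y*`. -/
def sampleCov {D M : ℕ} (Y : Matrix (Fin D) (Fin M) ℂ) : Matrix (Fin D) (Fin D) ℂ :=
  (1 / (M : ℂ)) • (Y * Yᴴ)

/-- The sum `∑ i j, conj (a k i) * a k j * C i j`, for a matrix `C`. -/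
def quadSum {D N : ℕ} (a : Fin N → EuclideanSpace ℂ (Fin D)) (C : Matrix (Fin D) (Fin D) ℂ)
    (k : Fin N) : ℂ :=
  ∑ i, ∑ j, conj (a k i) * a k j * C i j

/-- The statistic `𝒴 k`, as a real number; see `coe_stat`. -/
def stat {D N : ℕ} (a : Fin N → EuclideanSpace ℂ (Fin D)) (C : Matrix (Fin D) (Fin D) ℂ)
    (k : Fin N) : ℝ :=
  (quadSum a C k).re

/-- For a sample covariance matrix the sum that defines `𝒴 k` is real. -/
theorem coe_stat {D N M : ℕ} (a : Fin N → EuclideanSpace ℂ (Fin D))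
    (Y : Matrix (Fin D) (Fin M) ℂ) (k : Fin N) :
    (stat a (sampleCov Y) k : ℂ) = quadSum a (sampleCov Y) k := by
  rw [stat, ← Complex.conj_eq_iff_re]
  have hC : ∀ i j, conj (sampleCov Y i j) = sampleCov Y j i := by
    intro i j
    simp [sampleCov, Matrix.mul_apply, mul_comm]
  unfold quadSum
  conv_rhs => rw [Finset.sum_comm]
  simp only [map_sum, map_mul, Complex.conj_conj, hC]
  exact Finset.sum_congr rfl fun i _ => Finset.sum_congr rfl fun j _ => by ring

/-- The support of a vector. -/
def supp {N : ℕ} {R : Type*} [Zero R] (x : Fin N → R) : Finset (Fin N) :=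
  open Classical in Finset.univ.filter fun k => x k ≠ 0

/-- The smallest nonzero entry of a nonnegative vector. -/
def gammaMin {N : ℕ} (γ : Fin N → ℝ) (h : (supp γ).Nonempty) : ℝ := (supp γ).inf' h γ

/-- The largest entry of a nonnegative nonzero vector. -/
def gammaMax {N : ℕ} (γ : Fin N → ℝ) (h : (supp γ).Nonempty) : ℝ := (supp γ).sup' h γ

/-- `T` is a set of indices of `K` largest entries of `y` (unique up to the breaking of ties). -/
def IsLargest {N : ℕ} (K : ℕ) (y : Fin N → ℝ) (T : Finset (Fin N)) : Prop :=
  T.card = K ∧ ∀ i ∈ T, ∀ j ∉ T, y j ≤ y i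

/-- `v` results from `x` by hard thresholding: `K` entries of `x` that are largest in magnitude are
kept and the others are set to zero (ties may be broken in any way). -/
def IsHardThreshold {N : ℕ} (K : ℕ) (x v : Fin N → ℂ) : Prop :=
  ∃ T : Finset (Fin N), IsLargest K (fun k => ‖x k‖) T ∧ ∀ k, v k = if k ∈ T then x k else 0

/-- The matrix whose `k`-th column is `vec (a k (a k)*)`, with rows indexed by pairs. -/
def liftedCodebook {D N : ℕ} (a : Fin N → EuclideanSpace ℂ (Fin D)) :
    Matrix (Fin D × Fin D) (Fin N) ℂ :=
  Matrix.of fun p k => a k p.1 * conj (a k p.2)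

/-- The vector `u = vec (C - σ² I)`, for a matrix `C`. -/
def lsData {D : ℕ} (σ : ℝ≥0) (C : Matrix (Fin D) (Fin D) ℂ) : Fin D × Fin D → ℂ :=
  fun p => (C - ((σ : ℂ) ^ 2) • (1 : Matrix (Fin D) (Fin D) ℂ)) p.1 p.2

/-- The gradient step with step size one, `g + (1 / D²) B* (u - B g)`, for a matrix `B` with
`D²` rows. -/
def gradStep {D N : ℕ} (B : Matrix (Fin D × Fin D) (Fin N) ℂ) (u : Fin D × Fin D → ℂ)
    (g : Fin N → ℂ) : Fin N → ℂ :=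
  g + (1 / (D : ℂ) ^ 2) • (Bᴴ *ᵥ (u - B *ᵥ g))

/-- `g₁` is an output of one step of iterative hard thresholding at sparsity level `K`, started
at the zero vector. -/
def IsOneStepIHT {D N : ℕ} (K : ℕ) (σ : ℝ≥0) (a : Fin N → EuclideanSpace ℂ (Fin D))
    (C : Matrix (Fin D) (Fin D) ℂ) (g₁ : Fin N → ℂ) : Prop :=
  IsHardThreshold K (gradStep (liftedCodebook a) (lsData σ C) 0) g₁

/-- The sample covariance matrix of the received signal at the outcome `ω`. -/
def chanCov {Ω : Type*} {D N M : ℕ} (γ : Fin N → ℝ) (a : Fin N → Ω → EuclideanSpace ℂ (Fin D))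
    (H : Fin N → Fin M → Ω → ℂ) (Z : Fin D → Fin M → Ω → ℂ) (ω : Ω) :
    Matrix (Fin D) (Fin D) ℂ :=
  sampleCov (received (fun k => a k ω) γ (Matrix.of fun k j => H k j ω)
    (Matrix.of fun i j => Z i j ω))

end

end URA

namespace URA

/-! ### Concentration of sums of independent sub-exponential variables -/

/-! The statistic `𝒴 k` is `‖aₖ* Y‖² / M`, and `aₖ* Y` is a combination of the `K` active rows of
`H` and the `D` rows of `Z`, with coefficients `⟨aₖ, aₗ⟩ √γₗ` and the conjugated coordinates of
`aₖ`. If the sample covariance of these rows were exactly diagonal, `𝒴 k` would equal `γₖ D² + σ² D`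
plus the interference `∑_{l ≠ k} |⟨aₖ, aₗ⟩|² γₗ`. The term `σ² D` is common to all `k`, so the
support is visible as soon as interference and fluctuation are small against the gap `D² γ_min`.

Interference: spherical cap bounds (`toSphere_cap_le`) and a union bound over pairs give `|⟨aₖ,
aₗ⟩|² ≤ 8 D log (N D)`, and the condition on `K` makes the sum at most `D² γ_min / 8`.

Fluctuation: Bernstein's inequality (`measureReal_sum_ge_le`) bounds every entry of the row
covariance error by `η`, relative to the standard deviations. This event involves `H` and `Z` only,
hence serves all codewords at once. The error of `𝒴 k` is then at most `η` times the square of a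
weighted `ℓ¹` norm of the coefficients, and the condition on `M` makes this at most `D² γ_min / 8`
(`abs_stat_sub_le`).

So `𝒴 k - σ² D` is at least `3/4 D² γ_min` on the support and at most `1/4 D² γ_min` in absolute
value off it. One step of hard thresholding from zero acts on `(𝒴 k - σ² D) / D²`, so it selects the
same set (`supports_eq_of_abs_stat_sub_le`). -/

lemma exp_mul_le_of_abs_le_half {s x : ℝ} (hs : |s| ≤ 1 / 2) :
    Real.exp (s * x) ≤ 1 + s * x + 8 * s ^ 2 * Real.exp |x| := by
  have h1 : Real.exp (s * x) ≤ 1 + s * x + (s * x) ^ 2 * Real.exp |s * x| := by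
    have h := Complex.norm_exp_sub_sum_le_norm_mul_exp ((s * x : ℝ) : ℂ) 2
    simp only [Finset.sum_range_succ, Finset.sum_range_zero, Complex.norm_real,
      Real.norm_eq_abs, sq_abs] at h
    norm_num at h
    have h2 : ‖((Real.exp (s * x) - (1 + s * x) : ℝ) : ℂ)‖ ≤ (s * x) ^ 2 * Real.exp |s * x| := by
      push_cast
      simpa [abs_mul, mul_pow] using h
    rw [Complex.norm_real, Real.norm_eq_abs] at h2
    linarith [(abs_le.mp h2).2]
  have hx := abs_nonneg x
  have h2 : |s * x| ≤ |x| / 2 := by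
    rw [abs_mul]; nlinarith
  have h3 : x ^ 2 / 8 ≤ Real.exp (|x| / 2) := by
    have := Real.quadratic_le_exp_of_nonneg (x := |x| / 2) (by positivity)
    have h4 := sq_abs x
    nlinarith
  have h4 : Real.exp |s * x| ≤ Real.exp (|x| / 2) := Real.exp_le_exp.mpr h2
  have h5 : Real.exp |x| = Real.exp (|x| / 2) * Real.exp (|x| / 2) := by
    rw [← Real.exp_add]; ring_nf
  calc Real.exp (s * x) ≤ 1 + s * x + (s * x) ^ 2 * Real.exp |s * x| := h1
    _ ≤ 1 + s * x + (s * x) ^ 2 * Real.exp (|x| / 2) := by gcongr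
    _ = 1 + s * x + 8 * s ^ 2 * (x ^ 2 / 8 * Real.exp (|x| / 2)) := by ring
    _ ≤ 1 + s * x + 8 * s ^ 2 * (Real.exp (|x| / 2) * Real.exp (|x| / 2)) := by gcongr
    _ = _ := by rw [h5]

lemma integrable_of_integrable_exp_abs {ν : Measure ℝ}
    (hint : Integrable (fun x : ℝ => Real.exp |x|) ν) : Integrable (fun x : ℝ => x) ν :=
  hint.mono' (by fun_prop) (.of_forall fun x => by
    rw [Real.norm_eq_abs]; linarith [Real.add_one_le_exp |x|])

lemma integrable_exp_mul_of_integrable_exp_abs {ν : Measure ℝ}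
    (hint : Integrable (fun x : ℝ => Real.exp |x|) ν) {s : ℝ} (hs : |s| ≤ 1 / 2) :
    Integrable (fun x : ℝ => Real.exp (s * x)) ν :=
  hint.mono' (by fun_prop) (.of_forall fun x => by
    rw [Real.norm_eq_abs, Real.abs_exp, Real.exp_le_exp]
    calc s * x ≤ |s * x| := le_abs_self _
      _ = |s| * |x| := abs_mul _ _
      _ ≤ 1 * |x| := by gcongr; linarith
      _ = |x| := one_mul _)

/-- Integrating the pointwise bound removes the linear term by centring and leaves `1 + 8 C s²`. -/
lemma mgf_id_le_of_integral_exp_abs_le {ν : Measure ℝ} [IsProbabilityMeasure ν] {C : ℝ}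
    (hmean : ∫ x, x ∂ν = 0) (hint : Integrable (fun x : ℝ => Real.exp |x|) ν)
    (hC : ∫ x, Real.exp |x| ∂ν ≤ C) {s : ℝ} (hs : |s| ≤ 1 / 2) :
    mgf id ν s ≤ Real.exp (8 * C * s ^ 2) := by
  have hid := integrable_of_integrable_exp_abs hint
  calc mgf id ν s = ∫ x, Real.exp (s * x) ∂ν := rfl
    _ ≤ ∫ x, (1 + s * x + 8 * s ^ 2 * Real.exp |x|) ∂ν :=
        integral_mono (integrable_exp_mul_of_integrable_exp_abs hint hs)
          (((integrable_const _).add (hid.const_mul s)).add (hint.const_mul _))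
          fun x => exp_mul_le_of_abs_le_half hs
    _ = 1 + 8 * s ^ 2 * ∫ x, Real.exp |x| ∂ν := by
        have h1 : Integrable (fun x => 1 + s * x) ν := (integrable_const _).add (hid.const_mul s)
        rw [integral_add h1 (hint.const_mul _),
          integral_add (integrable_const _) (hid.const_mul s), integral_const_mul,
          integral_const_mul, hmean]
        simp
    _ ≤ 1 + 8 * s ^ 2 * C := by gcongr
    _ ≤ Real.exp (8 * C * s ^ 2) := by
        linarith [Real.add_one_le_exp (8 * C * s ^ 2)]

/-- Bernstein's inequality, one-sided, for independent centred variables with a common law that has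
an exponential moment. -/
lemma measureReal_sum_ge_le {Ω : Type*} [MeasurableSpace Ω] {μ : Measure Ω}
    {M : ℕ} {X : Fin M → Ω → ℝ} {ν : Measure ℝ} [IsProbabilityMeasure ν] {C : ℝ}
    (hmean : ∫ x, x ∂ν = 0) (hint : Integrable (fun x : ℝ => Real.exp |x|) ν)
    (hC : ∫ x, Real.exp |x| ∂ν ≤ C) (hX : iIndepFun X μ) (hlaw : ∀ m, HasLaw (X m) ν μ)
    {x : ℝ} (hx0 : 0 ≤ x) (hx4 : x ≤ 4) :
    μ.real {ω | M * x ≤ ∑ m, X m ω} ≤ Real.exp (-(M * x ^ 2 / (32 * C))) := by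
  have := hX.isProbabilityMeasure
  have hC1 : 1 ≤ C := by
    refine le_trans ?_ hC
    calc (1 : ℝ) = ∫ _, (1 : ℝ) ∂ν := by simp
      _ ≤ _ := integral_mono (integrable_const _) hint fun x => Real.one_le_exp (abs_nonneg x)
  -- The minimiser of the Chernoff exponent `-s x + 8 C s²`; `x ≤ 4` and `C ≥ 1` keep it in the
  -- range of the moment bound.
  set s : ℝ := x / (16 * C) with hs_def
  have hs0 : 0 ≤ s := by positivity
  have hs : |s| ≤ 1 / 2 := by
    rw [abs_of_nonneg hs0, hs_def, div_le_iff₀ (by positivity)]; linarith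
  have hm : ∀ m, AEMeasurable (X m) μ := fun m => (hlaw m).aemeasurable
  have hi : Integrable (fun ω => Real.exp (s * (∑ m, X m) ω)) μ := by
    have h : Integrable (fun y : Fin M → ℝ => ∏ m, Real.exp (s * y m)) (Measure.pi fun _ => ν) :=
      Integrable.fintype_prod fun _ => integrable_exp_mul_of_integrable_exp_abs hint hs
    have hl := hX.hasLaw_pi hlaw
    rw [← hl.map_eq] at h
    refine (h.comp_aemeasurable hl.aemeasurable).congr (.of_forall fun ω => ?_)
    simp [← Real.exp_sum, Finset.mul_sum]
  have hmgf : mgf (∑ m, X m) μ s ≤ Real.exp (8 * C * s ^ 2) ^ M := by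
    rw [hX.mgf_sum₀ hm]
    calc _ ≤ ∏ m : Fin M, Real.exp (8 * C * s ^ 2) := by
          refine Finset.prod_le_prod (fun m _ => mgf_nonneg) fun m _ => ?_
          have h := mgf_id_le_of_integral_exp_abs_le hmean hint hC hs
          rwa [← (hlaw m).map_eq, mgf_id_map (hm m)] at h
      _ = _ := by simp
  have hch := measure_ge_le_exp_mul_mgf (X := ∑ m, X m) (μ := μ) (M * x) hs0 hi
  simp only [Finset.sum_apply] at hch
  refine hch.trans ?_
  calc _ ≤ Real.exp (-s * (M * x)) * Real.exp (8 * C * s ^ 2) ^ M := by gcongr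
    _ = Real.exp (-s * (M * x) + M * (8 * C * s ^ 2)) := by
        rw [← Real.exp_nat_mul, ← Real.exp_add]
    _ = _ := by
        congr 1
        rw [hs_def]
        field_simp
        ring

lemma measureReal_abs_sum_ge_le {Ω : Type*} [MeasurableSpace Ω] {μ : Measure Ω}
    {M : ℕ} {X : Fin M → Ω → ℝ} {ν : Measure ℝ} [IsProbabilityMeasure ν] {C : ℝ}
    (hmean : ∫ x, x ∂ν = 0) (hint : Integrable (fun x : ℝ => Real.exp |x|) ν)
    (hC : ∫ x, Real.exp |x| ∂ν ≤ C) (hX : iIndepFun X μ) (hlaw : ∀ m, HasLaw (X m) ν μ)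
    {x : ℝ} (hx0 : 0 ≤ x) (hx4 : x ≤ 4) :
    μ.real {ω | M * x ≤ |∑ m, X m ω|} ≤ 2 * Real.exp (-(M * x ^ 2 / (32 * C))) := by
  have := hX.isProbabilityMeasure
  have h1 := measureReal_sum_ge_le hmean hint hC hX hlaw hx0 hx4
  have hneg : Measurable (fun x : ℝ => -x) := measurable_neg
  have : IsProbabilityMeasure (ν.map (fun x => -x)) :=
    Measure.isProbabilityMeasure_map hneg.aemeasurable
  have h2 := measureReal_sum_ge_le (ν := ν.map (fun x => -x)) (X := fun m ω => -X m ω) (C := C)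
    (by rw [integral_map hneg.aemeasurable (by fun_prop), integral_neg, hmean, neg_zero])
    (by
      rw [integrable_map_measure (by fun_prop) hneg.aemeasurable]
      simpa [Function.comp_def] using hint)
    (by
      rw [integral_map hneg.aemeasurable (by fun_prop)]
      simpa using hC)
    (hX.comp (fun _ x => -x) fun _ => hneg)
    (fun m => (HasLaw.mk (P := ν) hneg.aemeasurable rfl).fun_comp (hlaw m)) hx0 hx4
  have hsub : {ω | M * x ≤ |∑ m, X m ω|} ⊆
      {ω | M * x ≤ ∑ m, X m ω} ∪ {ω | M * x ≤ ∑ m, -X m ω} := by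
    intro ω hω
    simpa [le_abs, Finset.sum_neg_distrib] using hω
  calc _ ≤ _ := measureReal_mono hsub
    _ ≤ _ := measureReal_union_le _ _
    _ ≤ _ := by linarith

/-- Bernstein's inequality for complex variables that are distributed as multiples `s z` of a
centred variable `z` with an exponential moment. -/
lemma measureReal_norm_sum_gt_le {Ω : Type*} [MeasurableSpace Ω] {μ : Measure Ω}
    [IsProbabilityMeasure μ]
    {M : ℕ} {X : Fin M → Ω → ℂ} {ν : Measure ℂ} [IsProbabilityMeasure ν] {C s : ℝ}
    (hmean : ∫ z, z ∂ν = 0) (hint : Integrable (fun z : ℂ => Real.exp ‖z‖) ν)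
    (hC : ∫ z, Real.exp ‖z‖ ∂ν ≤ C) (hX : iIndepFun X μ) (hs : 0 ≤ s)
    (hlaw : ∀ m, HasLaw (X m) (ν.map fun z => (s : ℂ) * z) μ)
    {x : ℝ} (hx0 : 0 ≤ x) (hx4 : x ≤ 4) :
    μ.real {ω | M * (s * (2 * x)) < ‖∑ m, X m ω‖} ≤ 4 * Real.exp (-(M * x ^ 2 / (32 * C))) := by
  -- The degenerate case is needed for `σ = 0`: the variables vanish almost surely, and the event is
  -- null because its inequality is strict.
  rcases hs.eq_or_lt with rfl | hs
  · have h0 : ∀ m, X m =ᵐ[μ] fun _ => 0 := fun m => by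
      refine HasLaw.ae_eq_of_dirac ?_
      have := hlaw m
      simpa [Measure.map_const] using this
    have : μ {ω | M * ((0 : ℝ) * (2 * x)) < ‖∑ m, X m ω‖} = 0 := by
      have h := ae_all_iff.2 h0
      rw [measure_eq_zero_iff_ae_notMem]
      filter_upwards [h] with ω hω
      simp [hω]
    rw [measureReal_def, this]
    simp only [ENNReal.toReal_zero]
    positivity
  have hid : Integrable (fun z : ℂ => z) ν :=
    hint.mono' (by fun_prop) (.of_forall fun z => by linarith [Real.add_one_le_exp ‖z‖])
  -- Applied to real and imaginary parts; a contraction preserves both centring and the exponential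
  -- moment bound.
  have key : ∀ φ : ℂ →L[ℝ] ℝ, (∀ z, |φ z| ≤ ‖z‖) →
      μ.real {ω | M * x ≤ |∑ m, φ ((s : ℂ)⁻¹ * X m ω)|} ≤
        2 * Real.exp (-(M * x ^ 2 / (32 * C))) := by
    intro φ hφ
    have hφm : Measurable φ := φ.continuous.measurable
    have : IsProbabilityMeasure (ν.map φ) := Measure.isProbabilityMeasure_map hφm.aemeasurable
    have hint' : Integrable (fun z => Real.exp |φ z|) ν :=
      hint.mono' (by fun_prop) (.of_forall fun z => by
        rw [Real.norm_eq_abs, Real.abs_exp, Real.exp_le_exp]; exact hφ z)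
    refine measureReal_abs_sum_ge_le (ν := ν.map φ) ?_ ?_ ?_ ?_ ?_ hx0 hx4
    · rw [integral_map hφm.aemeasurable (by fun_prop), φ.integral_comp_comm hid, hmean, map_zero]
    · rw [integrable_map_measure (by fun_prop) hφm.aemeasurable]
      exact hint'
    · rw [integral_map hφm.aemeasurable (by fun_prop)]
      refine le_trans (integral_mono hint' hint fun z => ?_) hC
      exact Real.exp_le_exp.mpr (hφ z)
    · exact hX.comp (fun _ z => φ ((s : ℂ)⁻¹ * z)) fun _ => by fun_prop
    · intro m
      refine HasLaw.fun_comp (Y := fun z => φ ((s : ℂ)⁻¹ * z)) ⟨by fun_prop, ?_⟩ (hlaw m)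
      rw [Measure.map_map (by fun_prop) (by fun_prop)]
      congr 1
      ext z
      have : (s : ℂ) ≠ 0 := by exact_mod_cast hs.ne'
      simp [this]
  have hre := key Complex.reCLM fun z => Complex.abs_re_le_norm z
  have him := key Complex.imCLM fun z => Complex.abs_im_le_norm z
  have hsub : {ω | M * (s * (2 * x)) < ‖∑ m, X m ω‖} ⊆
      {ω | M * x ≤ |∑ m, Complex.reCLM ((s : ℂ)⁻¹ * X m ω)|} ∪
        {ω | M * x ≤ |∑ m, Complex.imCLM ((s : ℂ)⁻¹ * X m ω)|} := by
    intro ω hω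
    by_contra hcon
    simp only [Set.mem_union, Set.mem_ofPred_eq, not_or, not_le] at hcon hω
    rw [← map_sum, ← map_sum, ← Finset.mul_sum] at hcon
    have h1 := Complex.norm_le_abs_re_add_abs_im ((s : ℂ)⁻¹ * ∑ m, X m ω)
    simp only [Complex.reCLM_apply, Complex.imCLM_apply] at hcon
    have h2 : ‖(s : ℂ)⁻¹ * ∑ m, X m ω‖ < M * (2 * x) := by linarith
    rw [norm_mul, norm_inv, Complex.norm_real, Real.norm_of_nonneg hs.le,
      inv_mul_lt_iff₀ hs] at h2
    nlinarith
  calc _ ≤ _ := measureReal_mono hsub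
    _ ≤ _ := measureReal_union_le _ _
    _ ≤ _ := by linarith

/-! ### Products of complex Gaussian variables -/

lemma measurable_complex_mk : Measurable (fun p : ℝ × ℝ => (⟨p.1, p.2⟩ : ℂ)) :=
  Complex.measurableEquivRealProd.symm.measurable

instance isProbabilityMeasure_complexGaussian (v : ℝ≥0) :
    IsProbabilityMeasure (complexGaussian v) :=
  Measure.isProbabilityMeasure_map measurable_complex_mk.aemeasurable

/-- Reduces all row entries to multiples of one standard law, so that the same constants serve every
variance, including zero. -/
lemma complexGaussian_sq (s : ℝ≥0) :
    complexGaussian (s ^ 2) = (complexGaussian 1).map (fun z => ((s : ℝ) : ℂ) * z) := by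
  have h : gaussianReal 0 (s ^ 2 / 2) = (gaussianReal 0 (1 / 2)).map ((s : ℝ) * ·) := by
    rw [gaussianReal_map_const_mul, mul_zero]
    congr 1
    ext
    simp
    ring
  rw [complexGaussian, complexGaussian, h,
    Measure.map_prod_map _ _ (by fun_prop) (by fun_prop),
    Measure.map_map measurable_complex_mk (by fun_prop),
    Measure.map_map (by fun_prop) measurable_complex_mk]
  congr 1
  ext p
  apply Complex.ext <;> simp

/-- Fernique's theorem for the real and imaginary parts; since `|z|²` is the sum of their squares,
the exponential factorises. -/
lemma exists_integrable_exp_sq_complexGaussian :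
    ∃ κ : ℝ, 0 < κ ∧ Integrable (fun z : ℂ => Real.exp (κ * ‖z‖ ^ 2)) (complexGaussian 1) := by
  obtain ⟨κ, hκ, h⟩ := IsGaussian.exists_integrable_exp_sq (gaussianReal 0 (1 / 2))
  refine ⟨κ, hκ, ?_⟩
  rw [complexGaussian, integrable_map_measure (by fun_prop) measurable_complex_mk.aemeasurable]
  refine (h.mul_prod h).congr (.of_forall fun p => ?_)
  simp only [Function.comp_def, ← Real.exp_add, Complex.sq_norm, Complex.normSq_mk,
    Real.norm_eq_abs, sq_abs]
  ring_nf

lemma integral_id_complexGaussian_one : ∫ z, z ∂(complexGaussian 1) = 0 := by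
  have hg : Integrable (fun x : ℝ => x) (gaussianReal 0 (1 / 2)) :=
    (memLp_id_gaussianReal 1).integrable le_rfl
  have h1 : Integrable (fun p : ℝ × ℝ => (p.1 : ℂ))
      ((gaussianReal 0 (1 / 2)).prod (gaussianReal 0 (1 / 2))) := (hg.comp_fst _).ofReal
  have h2 : Integrable (fun p : ℝ × ℝ => (p.2 : ℂ))
      ((gaussianReal 0 (1 / 2)).prod (gaussianReal 0 (1 / 2))) := (hg.comp_snd _).ofReal
  rw [complexGaussian, integral_map measurable_complex_mk.aemeasurable (by fun_prop)]
  have : ∀ p : ℝ × ℝ, (⟨p.1, p.2⟩ : ℂ) = (p.1 : ℂ) + (p.2 : ℂ) * Complex.I := fun p =>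
    Complex.mk_eq_add_mul_I _ _
  simp_rw [this]
  rw [integral_add h1 (h2.mul_const _), integral_mul_const, integral_complex_ofReal,
    integral_complex_ofReal, integral_fun_fst (fun x : ℝ => x), integral_fun_snd (fun x : ℝ => x)]
  simp [integral_id_gaussianReal]

lemma integral_sq_norm_complexGaussian_one : ∫ z, ‖z‖ ^ 2 ∂(complexGaussian 1) = 1 := by
  have hg : Integrable (fun x : ℝ => x ^ 2) (gaussianReal 0 (1 / 2)) :=
    (memLp_id_gaussianReal 2).integrable_sq
  have hv : ∫ x, x ^ 2 ∂(gaussianReal 0 (1 / 2)) = 1 / 2 := by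
    have h := variance_fun_id_gaussianReal (μ := 0) (v := 1 / 2)
    rw [variance_eq_integral (by fun_prop)] at h
    simpa [integral_id_gaussianReal] using h
  rw [complexGaussian, integral_map measurable_complex_mk.aemeasurable (by fun_prop)]
  simp_rw [Complex.sq_norm, Complex.normSq_mk, ← sq]
  rw [integral_add (hg.comp_fst _) (hg.comp_snd _), integral_fun_fst (fun x : ℝ => x ^ 2),
    integral_fun_snd (fun x : ℝ => x ^ 2), hv]
  norm_num

/-- A centred probability measure on `ℂ` with an exponential moment bounded by `C`. -/
structure IsSubexponential (ν : Measure ℂ) (C : ℝ) : Prop where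
  prob : IsProbabilityMeasure ν
  mean : ∫ z, z ∂ν = 0
  integrable : Integrable (fun z : ℂ => Real.exp ‖z‖) ν
  bound : ∫ z, Real.exp ‖z‖ ∂ν ≤ C

/-- The law of `κ u v̄` for independent standard complex Gaussians `u` and `v`. -/
noncomputable def productLaw (κ : ℝ) : Measure ℂ :=
  ((complexGaussian 1).prod (complexGaussian 1)).map fun p => (κ : ℂ) * (p.1 * conj p.2)

/-- The law of `κ (|u|² - 1)` for a standard complex Gaussian `u`. -/
noncomputable def energyLaw (κ : ℝ) : Measure ℂ :=
  (complexGaussian 1).map fun u => (κ : ℂ) * (u * conj u - 1)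

/-- With `κ` from Fernique's theorem, `κ |u v̄| ≤ κ |u|² + κ |v|²` and `κ ||u|² - 1| ≤ κ |u|² + κ`
bound both exponential moments. These `κ` and `C` depend on the standard Gaussian law alone, which
makes the final constants universal. -/
lemma exists_isSubexponential :
    ∃ κ C : ℝ, 0 < κ ∧ 0 < C ∧ IsSubexponential (productLaw κ) C ∧
      IsSubexponential (energyLaw κ) C := by
  obtain ⟨κ, hκ, hexp⟩ := exists_integrable_exp_sq_complexGaussian
  have hP : Measurable fun p : ℂ × ℂ => (κ : ℂ) * (p.1 * conj p.2) := by fun_prop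
  have hE : Measurable fun u : ℂ => (κ : ℂ) * (u * conj u - 1) := by fun_prop
  have hPi : Integrable (fun z : ℂ => Real.exp ‖z‖) (productLaw κ) := by
    rw [productLaw, integrable_map_measure (by fun_prop) hP.aemeasurable]
    refine (hexp.mul_prod hexp).mono' (by fun_prop) (.of_forall fun p => ?_)
    simp only [Function.comp_def, ← Real.exp_add, Real.norm_eq_abs, Real.abs_exp, norm_mul,
      Complex.norm_real, RCLike.norm_conj, abs_of_pos hκ]
    rw [Real.exp_le_exp]
    nlinarith [sq_nonneg (‖p.1‖ - ‖p.2‖), sq_nonneg (‖p.1‖ + ‖p.2‖),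
      mul_nonneg hκ.le (sq_nonneg (‖p.1‖ - ‖p.2‖)), mul_nonneg hκ.le (sq_nonneg (‖p.1‖ + ‖p.2‖))]
  have hEi : Integrable (fun z : ℂ => Real.exp ‖z‖) (energyLaw κ) := by
    rw [energyLaw, integrable_map_measure (by fun_prop) hE.aemeasurable]
    refine (hexp.const_mul (Real.exp κ)).mono' (by fun_prop) (.of_forall fun u => ?_)
    simp only [Function.comp_def, ← Real.exp_add, Real.norm_eq_abs, Real.abs_exp, norm_mul,
      Complex.norm_real, abs_of_pos hκ]
    rw [Real.exp_le_exp]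
    have h := norm_sub_le (u * conj u) 1
    rw [norm_mul, RCLike.norm_conj, norm_one] at h
    nlinarith
  have hsq : Integrable (fun u : ℂ => u * conj u) (complexGaussian 1) := by
    refine (hexp.const_mul κ⁻¹).mono' (by fun_prop) (.of_forall fun u => ?_)
    rw [norm_mul, RCLike.norm_conj, ← sq, le_inv_mul_iff₀ hκ]
    linarith [Real.add_one_le_exp (κ * ‖u‖ ^ 2)]
  refine ⟨κ, max 1 (max (∫ z, Real.exp ‖z‖ ∂(productLaw κ)) (∫ z, Real.exp ‖z‖ ∂(energyLaw κ))),
    hκ, lt_max_of_lt_left one_pos, ⟨Measure.isProbabilityMeasure_map hP.aemeasurable, ?_, hPi,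
      le_max_of_le_right (le_max_left _ _)⟩, ⟨Measure.isProbabilityMeasure_map hE.aemeasurable,
      ?_, hEi, le_max_of_le_right (le_max_right _ _)⟩⟩
  · rw [productLaw, integral_map hP.aemeasurable (by fun_prop), integral_const_mul,
      integral_prod_mul (fun u : ℂ => u) (fun v : ℂ => conj v), integral_id_complexGaussian_one]
    simp
  · rw [energyLaw, integral_map hE.aemeasurable (by fun_prop), integral_const_mul,
      integral_sub hsq (integrable_const _)]
    have : ∀ u : ℂ, u * conj u = ((‖u‖ ^ 2 : ℝ) : ℂ) := fun u => by
      rw [Complex.mul_conj, Complex.sq_norm]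
    simp_rw [this]
    rw [integral_complex_ofReal, integral_sq_norm_complexGaussian_one]
    simp

/-- The joint law is a product of two product measures; regrouping the coordinates turns it into a
product over `m` of the pair laws. -/
lemma iIndepFun_prodMk_of_indepFun {Ω α : Type*} [MeasurableSpace Ω] [MeasurableSpace α]
    {μ : Measure Ω} [IsProbabilityMeasure μ] {M : ℕ} {U V : Fin M → Ω → α} {ν ρ : Measure α}
    [IsProbabilityMeasure ν] [IsProbabilityMeasure ρ]
    (hU : iIndepFun U μ) (hV : iIndepFun V μ)
    (hUV : IndepFun (fun ω m => U m ω) (fun ω m => V m ω) μ)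
    (hUl : ∀ m, HasLaw (U m) ν μ) (hVl : ∀ m, HasLaw (V m) ρ μ) :
    iIndepFun (fun m ω => (U m ω, V m ω)) μ ∧
      ∀ m, HasLaw (fun ω => (U m ω, V m ω)) (ν.prod ρ) μ := by
  have hpair : ∀ m, HasLaw (fun ω => (U m ω, V m ω)) (ν.prod ρ) μ := fun m =>
    (indepFun_iff_hasLaw_prodMk_prod (hUl m) (hVl m)).1
      (hUV.comp (φ := fun f : Fin M → α => f m) (ψ := fun f : Fin M → α => f m) (by fun_prop)
        (by fun_prop))
  refine ⟨(iIndepFun_iff_hasLaw_pi_pi hpair).2 ?_, hpair⟩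
  have h := (indepFun_iff_hasLaw_prodMk_prod (hU.hasLaw_pi hUl) (hV.hasLaw_pi hVl)).1 hUV
  exact ((measurePreserving_arrowProdEquivProdArrow α α (Fin M)
    (fun _ => ν) (fun _ => ρ)).symm).hasLaw.fun_comp h

lemma measureReal_norm_sum_mul_conj_gt_le {Ω : Type*} [MeasurableSpace Ω] {μ : Measure Ω}
    [IsProbabilityMeasure μ] {M : ℕ} {U V : Fin M → Ω → ℂ} {s t : ℝ≥0} {κ C : ℝ} (hκ : 0 < κ)
    (hν : IsSubexponential (productLaw κ) C)
    (hU : iIndepFun U μ) (hV : iIndepFun V μ)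
    (hUV : IndepFun (fun ω m => U m ω) (fun ω m => V m ω) μ)
    (hUl : ∀ m, HasLaw (U m) (complexGaussian (s ^ 2)) μ)
    (hVl : ∀ m, HasLaw (V m) (complexGaussian (t ^ 2)) μ)
    {x : ℝ} (hx0 : 0 ≤ x) (hx4 : x ≤ 4) :
    μ.real {ω | M * (s * t * (2 * x / κ)) < ‖∑ m, U m ω * conj (V m ω)‖} ≤
      4 * Real.exp (-(M * x ^ 2 / (32 * C))) := by
  have := hν.prob
  obtain ⟨hi, hl⟩ := iIndepFun_prodMk_of_indepFun hU hV hUV hUl hVl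
  have hf : Measurable fun p : ℂ × ℂ => (κ : ℂ) * (p.1 * conj p.2) := by fun_prop
  have h := measureReal_norm_sum_gt_le (X := fun m ω => (κ : ℂ) * (U m ω * conj (V m ω)))
    (s := s * t) hν.mean hν.integrable hν.bound (hi.comp _ fun _ => hf) (by positivity)
    (fun m => HasLaw.fun_comp (Y := fun p : ℂ × ℂ => (κ : ℂ) * (p.1 * conj p.2))
      ⟨hf.aemeasurable, by
        rw [complexGaussian_sq, complexGaussian_sq,
          Measure.map_prod_map _ _ (by fun_prop) (by fun_prop), Measure.map_map hf (by fun_prop),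
          productLaw, Measure.map_map (by fun_prop) hf]
        congr 1
        ext p
        simp
        ring⟩ (hl m)) hx0 hx4
  convert h using 3
  ext ω
  rw [← Finset.mul_sum, norm_mul, Complex.norm_real,
    Real.norm_of_nonneg hκ.le, ← div_lt_iff₀' hκ]
  ring_nf

/-- The diagonal covariance entries need their own law: a row is not independent of itself, and the
mean `s²` must be subtracted. -/
lemma measureReal_norm_sum_mul_conj_self_gt_le {Ω : Type*} [MeasurableSpace Ω] {μ : Measure Ω}
    [IsProbabilityMeasure μ] {M : ℕ} {U : Fin M → Ω → ℂ} {s : ℝ≥0} {κ C : ℝ} (hκ : 0 < κ)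
    (hν : IsSubexponential (energyLaw κ) C) (hU : iIndepFun U μ)
    (hUl : ∀ m, HasLaw (U m) (complexGaussian (s ^ 2)) μ)
    {x : ℝ} (hx0 : 0 ≤ x) (hx4 : x ≤ 4) :
    μ.real {ω | M * (s * s * (2 * x / κ)) < ‖∑ m, U m ω * conj (U m ω) - M * ((s : ℝ) : ℂ) ^ 2‖} ≤
      4 * Real.exp (-(M * x ^ 2 / (32 * C))) := by
  have := hν.prob
  have hf : Measurable fun u : ℂ => (κ : ℂ) * (u * conj u - ((s : ℝ) : ℂ) ^ 2) := by fun_prop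
  have h := measureReal_norm_sum_gt_le
    (X := fun m ω => (κ : ℂ) * (U m ω * conj (U m ω) - ((s : ℝ) : ℂ) ^ 2))
    (s := s * s) hν.mean hν.integrable hν.bound (hU.comp _ fun _ => hf) (by positivity)
    (fun m => HasLaw.fun_comp (Y := fun u : ℂ => (κ : ℂ) * (u * conj u - ((s : ℝ) : ℂ) ^ 2))
      ⟨hf.aemeasurable, by
        rw [complexGaussian_sq, Measure.map_map hf (by fun_prop),
          energyLaw, Measure.map_map (by fun_prop) (by fun_prop)]
        congr 1
        ext p
        simp
        ring⟩ (hUl m)) hx0 hx4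
  convert h using 3
  ext ω
  rw [← Finset.mul_sum, norm_mul, Complex.norm_real,
    Real.norm_of_nonneg hκ.le, ← div_lt_iff₀' hκ, Finset.sum_sub_distrib, Finset.sum_const,
    Finset.card_univ, Fintype.card_fin, nsmul_eq_mul]
  ring_nf

/-! ### Spherical caps -/

/-- Surface measure is proportional to the volume of the cone over the cap, and this cone lies in
the ball of radius `√(1 - τ²)` about `τ u`: for `0 ≤ r ≤ 1`, `‖r x - τ u‖² ≤ r² - 2 r τ² + τ²`,
which is convex in `r` and at most `1 - τ²` at both ends, at `r = 0` thanks to `τ² ≤ 1 / 2`. -/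
lemma toSphere_cap_le {E : Type*} [NormedAddCommGroup E] [InnerProductSpace ℝ E]
    [FiniteDimensional ℝ E] [MeasurableSpace E] [BorelSpace E] (μ : Measure E)
    [μ.IsAddHaarMeasure] {u : E} (hu : ‖u‖ = 1) {τ : ℝ} (hτ0 : 0 ≤ τ) (hτ : τ ^ 2 ≤ 1 / 2) :
    μ.toSphere {x | τ ≤ inner ℝ u (x : E)} ≤
      ENNReal.ofReal (√(1 - τ ^ 2) ^ Module.finrank ℝ E) * μ.toSphere Set.univ := by
  have hm : MeasurableSet {x : Metric.sphere (0 : E) 1 | τ ≤ inner ℝ u (x : E)} :=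
    measurableSet_le (by fun_prop) (by fun_prop)
  rw [Measure.toSphere_apply' _ hm, Measure.toSphere_apply_univ, mul_left_comm,
    ← Measure.addHaar_closedBall μ (τ • u) (Real.sqrt_nonneg _)]
  gcongr
  rintro _ ⟨r, ⟨hr0, hr1⟩, _, ⟨x, hx, rfl⟩, rfl⟩
  have hx1 : ‖(x : E)‖ = 1 := norm_eq_of_mem_sphere x
  have hx : τ ≤ inner ℝ u (x : E) := hx
  simp only [Metric.mem_closedBall, dist_eq_norm]
  refine Real.le_sqrt_of_sq_le ?_
  rw [norm_sub_sq_real, norm_smul, norm_smul, hu, hx1, inner_smul_left, inner_smul_right,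
    real_inner_comm]
  simp only [Real.norm_eq_abs, mul_one, sq_abs, RCLike.conj_to_real]
  have h1 : r * τ * τ ≤ r * τ * inner ℝ u (x : E) := by gcongr
  nlinarith

lemma finrank_real_euclideanSpace_complex (D : ℕ) :
    Module.finrank ℝ (EuclideanSpace ℂ (Fin D)) = 2 * D := by
  rw [← Module.finrank_mul_finrank ℝ ℂ, Complex.finrank_real_complex, finrank_euclideanSpace_fin]

lemma toSphere_univ_ne_zero {D : ℕ} (hD : 0 < D) :
    (volume : Measure (EuclideanSpace ℂ (Fin D))).toSphere Set.univ ≠ 0 := by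
  have : Nonempty (Fin D) := ⟨⟨0, hD⟩⟩
  rw [ne_eq, Measure.measure_univ_eq_zero]
  exact Measure.toSphere_ne_zero _

lemma measurable_smul_sphere (D : ℕ) :
    Measurable (fun x : Metric.sphere (0 : EuclideanSpace ℂ (Fin D)) 1 =>
      (√(D : ℝ)) • (x : EuclideanSpace ℂ (Fin D))) := by
  fun_prop

lemma isProbabilityMeasure_sphereUniform {D : ℕ} (hD : 0 < D) :
    IsProbabilityMeasure (sphereUniform D) := by
  have : IsProbabilityMeasure
      (((volume : Measure (EuclideanSpace ℂ (Fin D))).toSphere Set.univ)⁻¹ •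
        (volume : Measure (EuclideanSpace ℂ (Fin D))).toSphere) :=
    ⟨by
      rw [Measure.smul_apply, smul_eq_mul]
      exact ENNReal.inv_mul_cancel (toSphere_univ_ne_zero hD) (measure_ne_top _ _)⟩
  exact Measure.isProbabilityMeasure_map (measurable_smul_sphere D).aemeasurable

lemma ae_norm_sphereUniform (D : ℕ) : ∀ᵐ a ∂(sphereUniform D), ‖a‖ = √(D : ℝ) := by
  rw [sphereUniform, ae_map_iff (measurable_smul_sphere D).aemeasurable
    (measurableSet_eq_fun (by fun_prop) (by fun_prop))]
  refine .of_forall fun x => ?_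
  rw [norm_smul, norm_eq_of_mem_sphere x, mul_one, Real.norm_of_nonneg (Real.sqrt_nonneg _)]

lemma sphereUniform_cap_le {D : ℕ} (hD : 0 < D) {u : EuclideanSpace ℂ (Fin D)}
    (hu : ‖u‖ = √(D : ℝ)) {τ : ℝ} (hτ0 : 0 ≤ τ) (hτ : τ ^ 2 ≤ 1 / 2) :
    sphereUniform D {a | D * τ ≤ inner ℝ u a} ≤ ENNReal.ofReal (Real.exp (-(D * τ ^ 2))) := by
  have hD' : (0 : ℝ) < √(D : ℝ) := Real.sqrt_pos.2 (by exact_mod_cast hD)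
  have hDD : √(D : ℝ) * √(D : ℝ) = D := Real.mul_self_sqrt (by positivity)
  have hcap := toSphere_cap_le (volume : Measure (EuclideanSpace ℂ (Fin D)))
    (u := (√(D : ℝ))⁻¹ • u) (by
      rw [norm_smul, hu, norm_inv, Real.norm_of_nonneg hD'.le, inv_mul_cancel₀ hD'.ne']) hτ0 hτ
  rw [sphereUniform, Measure.map_apply (measurable_smul_sphere D)
    (measurableSet_le (by fun_prop) (by fun_prop)), Measure.smul_apply, smul_eq_mul]
  have hset : (fun x : Metric.sphere (0 : EuclideanSpace ℂ (Fin D)) 1 =>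
      (√(D : ℝ)) • (x : EuclideanSpace ℂ (Fin D))) ⁻¹' {a | D * τ ≤ inner ℝ u a} =
      {x : Metric.sphere (0 : EuclideanSpace ℂ (Fin D)) 1 |
        τ ≤ inner ℝ ((√(D : ℝ))⁻¹ • u) (x : EuclideanSpace ℂ (Fin D))} := by
    ext x
    simp only [Set.mem_preimage, Set.mem_ofPred_eq, inner_smul_left, inner_smul_right,
      RCLike.conj_to_real]
    rw [le_inv_mul_iff₀ hD']
    constructor
    · intro h
      refine le_of_mul_le_mul_left ?_ hD'
      rw [← mul_assoc, hDD]
      exact h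
    · intro h
      calc (D : ℝ) * τ = √(D : ℝ) * (√(D : ℝ) * τ) := by rw [← mul_assoc, hDD]
        _ ≤ _ := by gcongr
  rw [hset]
  calc _ ≤ (((volume : Measure (EuclideanSpace ℂ (Fin D))).toSphere Set.univ)⁻¹) *
        (ENNReal.ofReal (√(1 - τ ^ 2) ^ Module.finrank ℝ (EuclideanSpace ℂ (Fin D))) *
          (volume : Measure (EuclideanSpace ℂ (Fin D))).toSphere Set.univ) := by gcongr
    _ = ENNReal.ofReal (√(1 - τ ^ 2) ^ Module.finrank ℝ (EuclideanSpace ℂ (Fin D))) := by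
        rw [mul_left_comm, ENNReal.inv_mul_cancel (toSphere_univ_ne_zero hD) (measure_ne_top _ _),
          mul_one]
    _ ≤ _ := by
        refine ENNReal.ofReal_le_ofReal ?_
        -- The real dimension `2 D` cancels the square root.
        rw [finrank_real_euclideanSpace_complex, pow_mul, Real.sq_sqrt (by linarith)]
        calc (1 - τ ^ 2) ^ D ≤ Real.exp (-τ ^ 2) ^ D := by
              gcongr
              · linarith
              · linarith [Real.add_one_le_exp (-τ ^ 2)]
          _ = _ := by rw [← Real.exp_nat_mul]; ring_nf

lemma inner_real_eq_re_inner {D : ℕ} (u a : EuclideanSpace ℂ (Fin D)) :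
    inner ℝ u a = (inner ℂ u a).re := by
  simp [PiLp.inner_apply, Complex.inner]

/-- If `|z|² ≥ 2 t²`, then the real or the imaginary part of `z` has modulus at least `t`. This
gives four caps, about `±u` and `±i u`. -/
lemma sphereUniform_norm_inner_ge_le {D : ℕ} (hD : 0 < D) {u : EuclideanSpace ℂ (Fin D)}
    (hu : ‖u‖ = √(D : ℝ)) {τ : ℝ} (hτ0 : 0 ≤ τ) (hτ : τ ^ 2 ≤ 1 / 2) :
    sphereUniform D {a | 2 * (D * τ) ^ 2 ≤ ‖inner ℂ u a‖ ^ 2} ≤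
      ENNReal.ofReal (4 * Real.exp (-(D * τ ^ 2))) := by
  have hcap : ∀ c : ℂ, ‖c‖ = 1 → sphereUniform D {a | D * τ ≤ inner ℝ (c • u) a} ≤
      ENNReal.ofReal (Real.exp (-(D * τ ^ 2))) := fun c hc =>
    sphereUniform_cap_le hD (by rw [norm_smul, hc, one_mul, hu]) hτ0 hτ
  have hsub : {a | 2 * (D * τ) ^ 2 ≤ ‖inner ℂ u a‖ ^ 2} ⊆
      ({a | D * τ ≤ inner ℝ ((1 : ℂ) • u) a} ∪ {a | D * τ ≤ inner ℝ ((-1 : ℂ) • u) a}) ∪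
      ({a | D * τ ≤ inner ℝ (Complex.I • u) a} ∪ {a | D * τ ≤ inner ℝ (-Complex.I • u) a}) := by
    intro a ha
    simp only [Set.mem_union, Set.mem_ofPred_eq, inner_real_eq_re_inner, inner_smul_left,
      Complex.sq_norm, Complex.normSq_apply] at ha ⊢
    simp
    rw [← le_abs, ← le_abs]
    by_contra! hcon
    have h0 : 0 ≤ D * τ := by positivity
    nlinarith [abs_mul_abs_self (inner ℂ u a).re, abs_mul_abs_self (inner ℂ u a).im,
      abs_nonneg (inner ℂ u a).re, abs_nonneg (inner ℂ u a).im]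
  calc _ ≤ _ := measure_mono hsub
    _ ≤ _ := (measure_union_le _ _).trans
        (add_le_add (measure_union_le _ _) (measure_union_le _ _))
    _ ≤ (ENNReal.ofReal (Real.exp (-(D * τ ^ 2))) + ENNReal.ofReal (Real.exp (-(D * τ ^ 2)))) +
        (ENNReal.ofReal (Real.exp (-(D * τ ^ 2))) + ENNReal.ofReal (Real.exp (-(D * τ ^ 2)))) := by
      gcongr <;> exact hcap _ (by simp)
    _ = _ := by
      rw [← ENNReal.ofReal_add (by positivity) (by positivity),
        ← ENNReal.ofReal_add (by positivity) (by positivity)]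
      ring_nf

/-- Fubini: the cap bound is the same for every fixed first vector of norm `√D`. -/
lemma measure_norm_inner_ge_le_of_indepFun {Ω : Type*} [MeasurableSpace Ω] {μ : Measure Ω}
    [IsProbabilityMeasure μ] {D : ℕ} (hD : 0 < D) {U V : Ω → EuclideanSpace ℂ (Fin D)}
    (hU : HasLaw U (sphereUniform D) μ) (hV : HasLaw V (sphereUniform D) μ) (h : IndepFun U V μ)
    {τ : ℝ} (hτ0 : 0 ≤ τ) (hτ : τ ^ 2 ≤ 1 / 2) :
    μ {ω | 2 * (D * τ) ^ 2 ≤ ‖inner ℂ (U ω) (V ω)‖ ^ 2} ≤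
      ENNReal.ofReal (4 * Real.exp (-(D * τ ^ 2))) := by
  have := isProbabilityMeasure_sphereUniform hD
  have hlaw := (indepFun_iff_hasLaw_prodMk_prod hU hV).1 h
  have hm : MeasurableSet {p : EuclideanSpace ℂ (Fin D) × EuclideanSpace ℂ (Fin D) |
      2 * (D * τ) ^ 2 ≤ ‖inner ℂ p.1 p.2‖ ^ 2} :=
    measurableSet_le (by fun_prop) (by fun_prop)
  rw [hlaw.measure_eq (p := fun p => 2 * (D * τ) ^ 2 ≤ ‖inner ℂ p.1 p.2‖ ^ 2) hm,
    Measure.prod_apply hm]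
  calc _ ≤ ∫⁻ _, ENNReal.ofReal (4 * Real.exp (-(D * τ ^ 2))) ∂(sphereUniform D) := by
        refine lintegral_mono_ae ?_
        filter_upwards [ae_norm_sphereUniform D] with u hu
        exact sphereUniform_norm_inner_ge_le hD hu hτ0 hτ
    _ = _ := by simp

/-! ### Deterministic analysis of the statistic -/

/-- Expanding the quadratic form and applying the triangle inequality entry by entry, the errors `s
p * s q * η` factor into a squared weighted `ℓ¹` norm. -/
lemma norm_sum_mul_conj_sub_le {P : Type*} [Fintype P] [DecidableEq P] {M : ℕ} (c : P → ℂ)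
    (W : P → Fin M → ℂ) (s : P → ℝ) {η : ℝ}
    (hW : ∀ p q, ‖∑ m, W p m * conj (W q m) - if p = q then M * (s p : ℂ) ^ 2 else 0‖ ≤
      M * (s p * s q * η)) :
    ‖∑ m, (∑ p, c p * W p m) * conj (∑ p, c p * W p m) -
        ((M * ∑ p, ‖c p‖ ^ 2 * s p ^ 2 : ℝ) : ℂ)‖ ≤ M * (η * (∑ p, ‖c p‖ * s p) ^ 2) := by
  have hdiag : ((M * ∑ p, ‖c p‖ ^ 2 * s p ^ 2 : ℝ) : ℂ) =
      ∑ p, ∑ q, c p * conj (c q) * if p = q then M * (s p : ℂ) ^ 2 else 0 := by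
    simp only [mul_ite, mul_zero, Finset.sum_ite_eq, Finset.mem_univ, if_true]
    push_cast
    rw [Finset.mul_sum]
    refine Finset.sum_congr rfl fun p _ => ?_
    rw [Complex.mul_conj']
    ring
  have hquad : ∑ m, (∑ p, c p * W p m) * conj (∑ p, c p * W p m) =
      ∑ p, ∑ q, c p * conj (c q) * ∑ m, W p m * conj (W q m) := by
    simp only [map_sum, map_mul, Finset.sum_mul_sum]
    simp only [Finset.mul_sum]
    rw [Finset.sum_comm]
    refine Finset.sum_congr rfl fun p _ => ?_
    rw [Finset.sum_comm]
    exact Finset.sum_congr rfl fun q _ => Finset.sum_congr rfl fun m _ => by ring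
  rw [hdiag, hquad, ← Finset.sum_sub_distrib]
  simp_rw [← Finset.sum_sub_distrib, ← mul_sub]
  calc _ ≤ ∑ p, ∑ q, ‖c p‖ * ‖c q‖ * (M * (s p * s q * η)) := by
        refine (norm_sum_le _ _).trans (Finset.sum_le_sum fun p _ => ?_)
        refine (norm_sum_le _ _).trans (Finset.sum_le_sum fun q _ => ?_)
        rw [norm_mul, norm_mul, RCLike.norm_conj]
        gcongr
        exact hW p q
    _ = _ := by
        rw [sq, Finset.sum_mul_sum]
        simp only [Finset.mul_sum]
        exact Finset.sum_congr rfl fun p _ => Finset.sum_congr rfl fun q _ => by ring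

/-- The rows of `H` that belong to active indices, together with the rows of `Z`. -/
def stackedRows {D N M : ℕ} (γ : Fin N → ℝ) (H : Fin N → Fin M → ℂ) (Z : Fin D → Fin M → ℂ) :
    supp γ ⊕ Fin D → Fin M → ℂ :=
  Sum.elim (fun l => H l) Z

/-- The standard deviations of the entries of the stacked rows. -/
def stackedScale {N : ℕ} (D : ℕ) (γ : Fin N → ℝ) (σ : ℝ≥0) : supp γ ⊕ Fin D → ℝ≥0 :=
  Sum.elim (fun _ => 1) fun _ => σ

/-- The coefficients of `aₖ* Y` as a combination of the stacked rows. -/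
noncomputable def stackedCoeff {D N : ℕ} (a : Fin N → EuclideanSpace ℂ (Fin D)) (γ : Fin N → ℝ)
    (k : Fin N) : supp γ ⊕ Fin D → ℂ :=
  Sum.elim (fun l => inner ℂ (a k) (a l) * ((√(γ l) : ℝ) : ℂ)) fun i => conj (a k i)

lemma mem_supp {N : ℕ} {R : Type*} [Zero R] {x : Fin N → R} {k : Fin N} :
    k ∈ supp x ↔ x k ≠ 0 := by
  classical simp [supp]

/-- Inactive rows of `H` carry the factor `√0`. Only `K + D` rows remain, which keeps `N` out of the
union bound for the covariance. -/
lemma sum_stackedCoeff_mul {D N M : ℕ} (a : Fin N → EuclideanSpace ℂ (Fin D)) (γ : Fin N → ℝ)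
    (H : Fin N → Fin M → ℂ) (Z : Fin D → Fin M → ℂ) (k : Fin N) (m : Fin M) :
    ∑ p, stackedCoeff a γ k p * stackedRows γ H Z p m =
      ∑ i, conj (a k i) * received a γ (Matrix.of H) (Matrix.of Z) i m := by
  simp only [Fintype.sum_sum_type, stackedCoeff, stackedRows, Sum.elim_inl, Sum.elim_inr,
    received, Matrix.add_apply, mul_add, Finset.sum_add_distrib, Matrix.of_apply]
  congr 1
  rw [Finset.sum_coe_sort (supp γ)
    (fun l => inner ℂ (a k) (a l) * ((√(γ l) : ℝ) : ℂ) * H l m)]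
  rw [Finset.sum_subset (Finset.subset_univ (supp γ)) fun l _ hl => by
    rw [mem_supp, not_not] at hl; simp [hl]]
  simp only [Matrix.mul_apply (N := Matrix.of H), codebook, Matrix.mul_diagonal, Matrix.of_apply,
    Finset.mul_sum, PiLp.inner_apply, Finset.sum_mul]
  rw [Finset.sum_comm]
  refine Finset.sum_congr rfl fun i _ => Finset.sum_congr rfl fun l _ => ?_
  simp only [RCLike.inner_apply]
  ring

lemma quadSum_sampleCov {D N M : ℕ} (a : Fin N → EuclideanSpace ℂ (Fin D))
    (Y : Matrix (Fin D) (Fin M) ℂ) (k : Fin N) :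
    quadSum a (sampleCov Y) k =
      (1 / (M : ℂ)) * ∑ m, (∑ i, conj (a k i) * Y i m) * conj (∑ i, conj (a k i) * Y i m) := by
  simp only [quadSum, sampleCov, Matrix.smul_apply, Matrix.mul_apply, Matrix.conjTranspose_apply,
    smul_eq_mul, map_sum, map_mul, Complex.conj_conj, Finset.sum_mul_sum, RCLike.star_def]
  simp only [Finset.mul_sum]
  conv_rhs => rw [Finset.sum_comm]
  refine Finset.sum_congr rfl fun i _ => ?_
  conv_rhs => rw [Finset.sum_comm]
  exact Finset.sum_congr rfl fun j _ => Finset.sum_congr rfl fun m _ => by ring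

lemma abs_stat_sub_sum_le {D N M : ℕ} (hM : 0 < M) (a : Fin N → EuclideanSpace ℂ (Fin D))
    {γ : Fin N → ℝ} (H : Fin N → Fin M → ℂ) (Z : Fin D → Fin M → ℂ) (σ : ℝ≥0) {η : ℝ}
    (hW : ∀ p q, ‖∑ m, stackedRows γ H Z p m * conj (stackedRows γ H Z q m) -
        if p = q then M * (((stackedScale D γ σ p : ℝ≥0) : ℝ) : ℂ) ^ 2 else 0‖ ≤
      M * (stackedScale D γ σ p * stackedScale D γ σ q * η)) (k : Fin N) :
    |stat a (sampleCov (received a γ (Matrix.of H) (Matrix.of Z))) k -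
        ∑ p, ‖stackedCoeff a γ k p‖ ^ 2 * (stackedScale D γ σ p : ℝ) ^ 2| ≤
      η * (∑ p, ‖stackedCoeff a γ k p‖ * (stackedScale D γ σ p : ℝ)) ^ 2 := by
  have hM' : (0 : ℝ) < M := by exact_mod_cast hM
  have hMc : (M : ℂ) ≠ 0 := by exact_mod_cast hM.ne'
  have h := norm_sum_mul_conj_sub_le (stackedCoeff a γ k) (stackedRows γ H Z)
    (fun p => (stackedScale D γ σ p : ℝ)) (η := η) hW
  simp only [sum_stackedCoeff_mul] at h
  rw [← Real.norm_eq_abs, ← Complex.norm_real, Complex.ofReal_sub, coe_stat, quadSum_sampleCov,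
    ← mul_le_mul_iff_right₀ hM']
  refine le_trans (le_of_eq ?_) h
  have hnorm : ∀ w : ℂ, (M : ℝ) * ‖w‖ = ‖(M : ℂ) * w‖ := fun w => by
    rw [norm_mul, Complex.norm_natCast]
  rw [hnorm, mul_sub, ← mul_assoc, mul_one_div_cancel hMc, one_mul, Complex.ofReal_mul,
    Complex.ofReal_natCast]

/-- The error budget `D² g / 4` is split evenly between the interference in the mean `T` and the
fluctuation `η R²` about it. Here `g`, `G` and `L` stand for `γ_min`, `γ_max` and `log (N D)`. -/
lemma abs_stat_sub_le {D N M : ℕ} (hM : 0 < M) (a : Fin N → EuclideanSpace ℂ (Fin D))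
    {γ : Fin N → ℝ} (hγ : ∀ k, 0 ≤ γ k) (H : Fin N → Fin M → ℂ) (Z : Fin D → Fin M → ℂ) (σ : ℝ≥0)
    {g G L η : ℝ} (hg : 0 < g) (hgG : g ≤ G) (hG : ∀ k, γ k ≤ G) (hL : 0 ≤ L) (hη0 : 0 ≤ η)
    (hK1 : 1 ≤ (supp γ).card)
    (ha : ∀ k, ‖a k‖ = √(D : ℝ))
    (hcoh : ∀ k l, k ≠ l → ‖inner ℂ (a k) (a l)‖ ^ 2 ≤ 8 * D * L)
    (hW : ∀ p q, ‖∑ m, stackedRows γ H Z p m * conj (stackedRows γ H Z q m) -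
        if p = q then M * (((stackedScale D γ σ p : ℝ≥0) : ℝ) : ℂ) ^ 2 else 0‖ ≤
      M * (stackedScale D γ σ p * stackedScale D γ σ q * η))
    (hK : (supp γ).card * (G * L) ≤ 1 / 64 * D * g)
    (hη : η * (G * (supp γ).card + (σ : ℝ) ^ 2) ≤ g / 48) (k : Fin N) :
    |stat a (sampleCov (received a γ (Matrix.of H) (Matrix.of Z))) k - (σ : ℝ) ^ 2 * D
      - γ k * D ^ 2| ≤ D ^ 2 * g / 4 := by
  have hG0 : 0 < G := hg.trans_le hgG
  have hM' : (0 : ℝ) < M := by exact_mod_cast hM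
  have hDD : √(D : ℝ) ^ 2 = D := Real.sq_sqrt (by positivity)
  have hself : ‖inner ℂ (a k) (a k)‖ = D := by
    rw [inner_self_eq_norm_sq_to_K, ha]
    norm_cast
    rw [hDD]
    simp
  set K : ℝ := ((supp γ).card : ℝ) with hKdef
  have hK1' : 1 ≤ K := Nat.one_le_cast.2 hK1
  set T := ∑ p, ‖stackedCoeff a γ k p‖ ^ 2 * (stackedScale D γ σ p : ℝ) ^ 2 with hT
  have hTeq : T = ∑ l ∈ supp γ, ‖inner ℂ (a k) (a l)‖ ^ 2 * γ l + (σ : ℝ) ^ 2 * D := by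
    rw [hT, Fintype.sum_sum_type]
    congr 1
    · rw [← Finset.sum_coe_sort (supp γ)]
      refine Finset.sum_congr rfl fun l _ => ?_
      simp only [stackedCoeff, stackedScale, Sum.elim_inl, norm_mul, Complex.norm_real, mul_pow,
        Real.norm_eq_abs, sq_abs, Real.sq_sqrt (hγ l), NNReal.coe_one, one_pow, mul_one]
    · simp only [stackedCoeff, stackedScale, Sum.elim_inr, RCLike.norm_conj]
      rw [← Finset.sum_mul, ← EuclideanSpace.norm_sq_eq, ha, hDD, mul_comm]
  have hlow : γ k * D ^ 2 ≤ ∑ l ∈ supp γ, ‖inner ℂ (a k) (a l)‖ ^ 2 * γ l := by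
    by_cases hk : k ∈ supp γ
    · have := Finset.single_le_sum (f := fun l => ‖inner ℂ (a k) (a l)‖ ^ 2 * γ l)
        (fun l _ => mul_nonneg (sq_nonneg _) (hγ l)) hk
      simp only [hself] at this
      linarith
    · rw [mem_supp, not_not] at hk
      rw [hk, zero_mul]
      exact Finset.sum_nonneg fun l _ => mul_nonneg (sq_nonneg _) (hγ l)
  have hup : ∑ l ∈ supp γ, ‖inner ℂ (a k) (a l)‖ ^ 2 * γ l ≤
      γ k * D ^ 2 + K * (8 * D * L * G) := by
    calc _ ≤ ∑ l ∈ supp γ, ((if l = k then γ k * D ^ 2 else 0) + 8 * D * L * G) := by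
          refine Finset.sum_le_sum fun l _ => ?_
          split_ifs with h
          · rw [h, hself]
            have : 0 ≤ 8 * D * L * G := by positivity
            linarith
          · rw [zero_add]
            exact mul_le_mul (hcoh k l (Ne.symm h)) (hG l) (hγ l) (by positivity)
      _ ≤ _ := by
          rw [Finset.sum_add_distrib, Finset.sum_const, nsmul_eq_mul, Finset.sum_ite_eq']
          gcongr
          split_ifs
          · exact le_rfl
          · exact mul_nonneg (hγ k) (by positivity)
  have hint : K * (8 * D * L * G) ≤ D ^ 2 * g / 8 := by
    have := mul_le_mul_of_nonneg_left hK (show (0 : ℝ) ≤ 8 * D by positivity)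
    linarith
  set R := ∑ p, ‖stackedCoeff a γ k p‖ * (stackedScale D γ σ p : ℝ) with hR
  have hR0 : 0 ≤ R := Finset.sum_nonneg fun p _ => by positivity
  have hRle : R ≤ D * √G + K * (√(8 * D * L) * √G) + σ * D := by
    rw [hR, Fintype.sum_sum_type]
    gcongr
    · simp only [stackedCoeff, stackedScale, Sum.elim_inl, norm_mul, Complex.norm_real,
        Real.norm_of_nonneg (Real.sqrt_nonneg _), NNReal.coe_one, mul_one]
      rw [Finset.sum_coe_sort (supp γ) (fun l => ‖inner ℂ (a k) (a l)‖ * √(γ l))]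
      calc _ ≤ ∑ l ∈ supp γ, ((if l = k then D * √G else 0) + √(8 * D * L) * √G) := by
            refine Finset.sum_le_sum fun l _ => ?_
            have hsq : √(γ l) ≤ √G := Real.sqrt_le_sqrt (hG l)
            split_ifs with h
            · rw [h] at hsq
              rw [h, hself]
              have : (D : ℝ) * √(γ k) ≤ D * √G := by gcongr
              have : 0 ≤ √(8 * D * L) * √G := by positivity
              linarith
            · rw [zero_add]
              gcongr
              exact Real.le_sqrt_of_sq_le (hcoh k l (Ne.symm h))
        _ ≤ _ := by
            rw [Finset.sum_add_distrib, Finset.sum_const, nsmul_eq_mul, Finset.sum_ite_eq']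
            gcongr
            split_ifs
            · exact le_rfl
            · positivity
    · simp only [stackedCoeff, stackedScale, Sum.elim_inr, RCLike.norm_conj]
      rw [← Finset.sum_mul, mul_comm]
      gcongr
      -- Cauchy–Schwarz: the `ℓ¹` norm of a codeword is at most `√D * √D = D`.
      have h := sq_sum_le_card_mul_sum_sq (s := Finset.univ) (f := fun i => ‖a k i‖)
      rw [← EuclideanSpace.norm_sq_eq, ha, hDD, Finset.card_univ, Fintype.card_fin, ← sq] at h
      exact (sq_le_sq₀ (by positivity) (by positivity)).1 h
  have hRsq : R ^ 2 ≤ 6 * D ^ 2 * (G * K + (σ : ℝ) ^ 2) := by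
    have h1 : (√G) ^ 2 = G := Real.sq_sqrt hG0.le
    have h2 : (√(8 * D * L)) ^ 2 = 8 * D * L := Real.sq_sqrt (by positivity)
    calc R ^ 2 ≤ (D * √G + K * (√(8 * D * L) * √G) + σ * D) ^ 2 := by gcongr
      _ ≤ 3 * ((D * √G) ^ 2 + (K * (√(8 * D * L) * √G)) ^ 2 + (σ * D) ^ 2) := by
          nlinarith [sq_nonneg (D * √G - K * (√(8 * D * L) * √G)), sq_nonneg (D * √G - σ * D),
            sq_nonneg (K * (√(8 * D * L) * √G) - σ * D)]
      _ = 3 * (D ^ 2 * G + K * (K * (8 * D * L * G)) + D ^ 2 * (σ : ℝ) ^ 2) := by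
          rw [mul_pow, mul_pow, mul_pow, mul_pow, h1, h2]; ring
      _ ≤ 3 * (D ^ 2 * (G * K) + K * (D ^ 2 * G) + D ^ 2 * (σ : ℝ) ^ 2) := by
          -- The coherence condition absorbs one of the two factors `K` in the squared cross term,
          -- so that the bound on `R ^ 2` is linear in `K`.
          have h3 : K * (8 * D * L * G) ≤ D ^ 2 * G := by
            have : (D : ℝ) ^ 2 * g ≤ D ^ 2 * G := by gcongr
            have : 0 ≤ (D : ℝ) ^ 2 * g := by positivity
            linarith
          have h4 : G ≤ G * K := le_mul_of_one_le_right hG0.le hK1'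
          have h5 : K * (K * (8 * D * L * G)) ≤ K * (D ^ 2 * G) := by gcongr
          gcongr
      _ ≤ _ := by nlinarith [sq_nonneg ((D : ℝ) * σ)]
  have hfluct : η * R ^ 2 ≤ D ^ 2 * g / 8 := by
    calc η * R ^ 2 ≤ η * (6 * D ^ 2 * (G * K + (σ : ℝ) ^ 2)) := by gcongr
      _ = 6 * D ^ 2 * (η * (G * K + (σ : ℝ) ^ 2)) := by ring
      _ ≤ 6 * D ^ 2 * (g / 48) := by gcongr
      _ = _ := by ring
  have hdev := abs_stat_sub_sum_le hM a H Z σ hW k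
  rw [← hT, ← hR] at hdev
  rw [abs_le] at hdev ⊢
  constructor <;> linarith [hdev.1, hdev.2]

/-! ### Concentration of the sample covariance of the stacked rows -/

lemma indepFun_rows {Ω ι κ α : Type*} [MeasurableSpace Ω] {μ : Measure Ω} [MeasurableSpace α]
    [Fintype κ] {X : ι → κ → Ω → α}
    (h : iIndepFun (fun p : ι × κ => X p.1 p.2) μ) (hm : ∀ i j, AEMeasurable (X i j) μ)
    {i i' : ι} (hi : i ≠ i') :
    IndepFun (fun ω j => X i j ω) (fun ω j => X i' j ω) μ := by
  classical
  set A : ι → Finset (ι × κ) := fun i => Finset.univ.image fun j => (i, j) with hA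
  have hdisj : Disjoint (A i) (A i') := by
    rw [Finset.disjoint_left]
    rintro p hp hp'
    simp only [hA, Finset.mem_image, Finset.mem_univ, true_and] at hp hp'
    obtain ⟨j, rfl⟩ := hp
    obtain ⟨j', hj'⟩ := hp'
    exact hi (congrArg Prod.fst hj').symm
  have hmem : ∀ i j, (i, j) ∈ A i := fun i j => by simp [hA]
  exact (h.indepFun_finset₀ (A i) (A i') hdisj fun p => hm p.1 p.2).comp
    (φ := fun f j => f ⟨(i, j), hmem i j⟩) (ψ := fun f j => f ⟨(i', j), hmem i' j⟩)
    (measurable_pi_lambda _ fun _ => measurable_pi_apply _)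
    (measurable_pi_lambda _ fun _ => measurable_pi_apply _)

lemma IsChannel.iIndepFun_stackedRows {Ω : Type*} [MeasurableSpace Ω] {μ : Measure Ω}
    {D N M : ℕ} {σ : ℝ≥0} {a : Fin N → Ω → EuclideanSpace ℂ (Fin D)} {H : Fin N → Fin M → Ω → ℂ}
    {Z : Fin D → Fin M → Ω → ℂ} (h : IsChannel μ σ a H Z) (γ : Fin N → ℝ) (p : supp γ ⊕ Fin D) :
    iIndepFun (fun m ω => stackedRows γ (fun k j => H k j ω) (fun i j => Z i j ω) p m) μ := by
  rcases p with l | i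
  · exact h.indep_fading.precomp (g := fun m => ((l : Fin N), m)) fun _ _ hm => (Prod.ext_iff.1 hm).2
  · exact h.indep_noise.precomp (g := fun m => (i, m)) fun _ _ hm => (Prod.ext_iff.1 hm).2

lemma IsChannel.hasLaw_stackedRows {Ω : Type*} [MeasurableSpace Ω] {μ : Measure Ω}
    {D N M : ℕ} {σ : ℝ≥0} {a : Fin N → Ω → EuclideanSpace ℂ (Fin D)} {H : Fin N → Fin M → Ω → ℂ}
    {Z : Fin D → Fin M → Ω → ℂ} (h : IsChannel μ σ a H Z) (γ : Fin N → ℝ) (p : supp γ ⊕ Fin D)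
    (m : Fin M) :
    HasLaw (fun ω => stackedRows γ (fun k j => H k j ω) (fun i j => Z i j ω) p m)
      (complexGaussian (stackedScale D γ σ p ^ 2)) μ := by
  rcases p with l | i
  · simpa [stackedRows, stackedScale] using h.law_fading l m
  · simpa [stackedRows, stackedScale] using h.law_noise i m

lemma IsChannel.indepFun_stackedRows {Ω : Type*} [MeasurableSpace Ω] {μ : Measure Ω}
    {D N M : ℕ} {σ : ℝ≥0} {a : Fin N → Ω → EuclideanSpace ℂ (Fin D)} {H : Fin N → Fin M → Ω → ℂ}
    {Z : Fin D → Fin M → Ω → ℂ} (h : IsChannel μ σ a H Z) (γ : Fin N → ℝ)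
    {p q : supp γ ⊕ Fin D} (hpq : p ≠ q) :
    IndepFun (fun ω m => stackedRows γ (fun k j => H k j ω) (fun i j => Z i j ω) p m)
      (fun ω m => stackedRows γ (fun k j => H k j ω) (fun i j => Z i j ω) q m) μ := by
  have hHZ : ∀ (l : Fin N) (i : Fin D),
      IndepFun (fun ω m => H l m ω) (fun ω m => Z i m ω) μ := fun l i =>
    h.indep_fading_noise.comp (φ := fun f m => f l m) (ψ := fun f m => f i m)
      (measurable_pi_lambda _ fun _ => by fun_prop) (measurable_pi_lambda _ fun _ => by fun_prop)
  rcases p with l | i <;> rcases q with l' | i'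
  · exact indepFun_rows h.indep_fading (fun k j => (h.law_fading k j).aemeasurable)
      fun hl => hpq (congrArg Sum.inl (Subtype.ext hl))
  · exact hHZ l i'
  · exact (hHZ l' i).symm
  · exact indepFun_rows h.indep_noise (fun k j => (h.law_noise k j).aemeasurable)
      fun hl => hpq (congrArg Sum.inr hl)

/-- The event that the `(p, q)` entry of the sample covariance of the stacked rows deviates from its
mean by more than `η`, relative to the standard deviations. -/
def deviationEvent {Ω : Type*} {D N M : ℕ} (γ : Fin N → ℝ) (σ : ℝ≥0) (H : Fin N → Fin M → Ω → ℂ)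
    (Z : Fin D → Fin M → Ω → ℂ) (η : ℝ) (p q : supp γ ⊕ Fin D) : Set Ω :=
  {ω | M * (stackedScale D γ σ p * stackedScale D γ σ q * η) <
    ‖∑ m, stackedRows γ (fun k j => H k j ω) (fun i j => Z i j ω) p m *
        conj (stackedRows γ (fun k j => H k j ω) (fun i j => Z i j ω) q m) -
      if p = q then M * (((stackedScale D γ σ p : ℝ≥0) : ℝ) : ℂ) ^ 2 else 0‖}

lemma IsChannel.measureReal_deviationEvent_le {Ω : Type*} [MeasurableSpace Ω] {μ : Measure Ω}
    [IsProbabilityMeasure μ] {D N M : ℕ} {σ : ℝ≥0} {a : Fin N → Ω → EuclideanSpace ℂ (Fin D)}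
    {H : Fin N → Fin M → Ω → ℂ} {Z : Fin D → Fin M → Ω → ℂ} (h : IsChannel μ σ a H Z)
    (γ : Fin N → ℝ) {κ C : ℝ} (hκ : 0 < κ) (hP : IsSubexponential (productLaw κ) C)
    (hE : IsSubexponential (energyLaw κ) C) {x : ℝ} (hx0 : 0 ≤ x) (hx4 : x ≤ 4)
    (p q : supp γ ⊕ Fin D) :
    μ.real (deviationEvent γ σ H Z (2 * x / κ) p q) ≤ 4 * Real.exp (-(M * x ^ 2 / (32 * C))) := by
  by_cases hpq : p = q
  · subst hpq
    simp only [deviationEvent, if_true]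
    exact measureReal_norm_sum_mul_conj_self_gt_le hκ hE (h.iIndepFun_stackedRows γ p)
      (h.hasLaw_stackedRows γ p) hx0 hx4
  · simp only [deviationEvent, hpq, if_false, sub_zero]
    exact measureReal_norm_sum_mul_conj_gt_le hκ hP (h.iIndepFun_stackedRows γ p)
      (h.iIndepFun_stackedRows γ q) (h.indepFun_stackedRows γ hpq)
      (h.hasLaw_stackedRows γ p) (h.hasLaw_stackedRows γ q) hx0 hx4

/-! ### Support selection -/

/-- Equal cardinalities turn an element of `T \ S` into one of `S \ T`, and the two contradict the
separation. No tie can occur across the boundary of `S`, so tie-breaking is irrelevant. -/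
lemma IsLargest.eq_of_separated {N K : ℕ} {y : Fin N → ℝ} {S T : Finset (Fin N)}
    (hT : IsLargest K y T) (hS : S.card = K) (hsep : ∀ i ∈ S, ∀ j ∉ S, y j < y i) : T = S := by
  refine Finset.eq_of_subset_of_card_le (fun i hi => ?_) (by rw [hT.1, hS])
  by_contra hiS
  obtain ⟨j, hjS, hjT⟩ : ∃ j ∈ S, j ∉ T := by
    by_contra! hcon
    have := Finset.eq_of_subset_of_card_le hcon (by rw [hT.1, hS])
    exact hiS (this ▸ hi)
  exact absurd (hT.2 i hi j hjT) (not_le.2 (hsep j hjS i hiS))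

/-- The link between the two algorithms: pairing `vec (aₖ aₖ*)` with `vec C` gives the quadratic
form of `C` at `aₖ`, and pairing it with the identity gives `‖aₖ‖²`. -/
lemma gradStep_liftedCodebook_zero {D N : ℕ} (σ : ℝ≥0) (a : Fin N → EuclideanSpace ℂ (Fin D))
    (C : Matrix (Fin D) (Fin D) ℂ) (k : Fin N) :
    gradStep (liftedCodebook a) (lsData σ C) 0 k =
      (1 / (D : ℂ) ^ 2) * (quadSum a C k - (((σ : ℝ) ^ 2 * ‖a k‖ ^ 2 : ℝ) : ℂ)) := by
  simp only [gradStep, Matrix.mulVec_zero, sub_zero, zero_add, Pi.smul_apply, smul_eq_mul]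
  congr 1
  simp only [Matrix.mulVec, dotProduct, Matrix.conjTranspose_apply, liftedCodebook, lsData,
    Matrix.of_apply, Fintype.sum_prod_type, Matrix.sub_apply, Matrix.smul_apply, mul_sub,
    Finset.sum_sub_distrib, smul_eq_mul, quadSum, RCLike.star_def, map_mul, Complex.conj_conj]
  congr 1
  simp only [Matrix.one_apply, mul_ite, mul_one, mul_zero, Finset.sum_ite_eq, Finset.mem_univ,
    if_true]
  rw [EuclideanSpace.norm_sq_eq]
  push_cast
  rw [Finset.mul_sum]
  refine Finset.sum_congr rfl fun i _ => ?_
  rw [Complex.conj_mul']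
  ring

/-- Thresholding compares magnitudes, so off the support the two-sided bound on the centred
statistic is needed. The lower bound on the support also shows that the kept entries are nonzero. -/
lemma supports_eq_of_abs_stat_sub_le {D N M K : ℕ} (hD : 0 < D) (σ : ℝ≥0)
    {a : Fin N → EuclideanSpace ℂ (Fin D)} (ha : ∀ k, ‖a k‖ = √(D : ℝ)) {γ : Fin N → ℝ}
    {Y : Matrix (Fin D) (Fin M) ℂ} {g : ℝ} (hg : 0 < g) (hmin : ∀ k ∈ supp γ, g ≤ γ k)
    (hK : (supp γ).card = K)
    (hstat : ∀ k, |stat a (sampleCov Y) k - (σ : ℝ) ^ 2 * D - γ k * D ^ 2| ≤ D ^ 2 * g / 4)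
    {T : Finset (Fin N)} (hT : IsLargest K (stat a (sampleCov Y)) T) :
    T = supp γ ∧ ∀ γ₁ : Fin N → ℂ, IsOneStepIHT K σ a (sampleCov Y) γ₁ → supp γ₁ = supp γ := by
  have hD2 : (0 : ℝ) < (D : ℝ) ^ 2 := by positivity
  have hout : ∀ j ∉ supp γ, |stat a (sampleCov Y) j - (σ : ℝ) ^ 2 * D| ≤ D ^ 2 * g / 4 := by
    intro j hj
    rw [mem_supp, not_not] at hj
    simpa [hj] using hstat j
  have hin : ∀ i ∈ supp γ, D ^ 2 * g * (3 / 4) ≤ stat a (sampleCov Y) i - (σ : ℝ) ^ 2 * D := by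
    intro i hi
    have h1 : (D : ℝ) ^ 2 * g ≤ γ i * D ^ 2 := by
      rw [mul_comm]; exact mul_le_mul_of_nonneg_right (hmin i hi) hD2.le
    linarith [(abs_le.1 (hstat i)).1]
  have hpos : 0 < (D : ℝ) ^ 2 * g := by positivity
  refine ⟨hT.eq_of_separated hK fun i hi j hj => ?_, ?_⟩
  · linarith [hin i hi, (abs_le.1 (hout j hj)).2]
  rintro γ₁ ⟨T₁, hT₁, hγ₁⟩
  have hgrad : ∀ k, gradStep (liftedCodebook a) (lsData σ (sampleCov Y)) 0 k =
      (((1 / (D : ℝ) ^ 2) * (stat a (sampleCov Y) k - (σ : ℝ) ^ 2 * D) : ℝ) : ℂ) := fun k => by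
    rw [gradStep_liftedCodebook_zero, ← coe_stat, ha, Real.sq_sqrt (by positivity)]
    push_cast
    ring
  have hnorm : ∀ k, ‖gradStep (liftedCodebook a) (lsData σ (sampleCov Y)) 0 k‖ =
      (1 / (D : ℝ) ^ 2) * |stat a (sampleCov Y) k - (σ : ℝ) ^ 2 * D| := fun k => by
    rw [hgrad, Complex.norm_real, Real.norm_eq_abs, abs_mul, abs_of_pos (by positivity)]
  have hT₁S : T₁ = supp γ := hT₁.eq_of_separated hK fun i hi j hj => by
    rw [hnorm, hnorm]
    gcongr 1
    refine (hout j hj).trans_lt (lt_of_lt_of_le ?_ (le_abs_self _))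
    linarith [hin i hi]
  ext k
  rw [mem_supp, hγ₁, hT₁S]
  constructor
  · intro h
    by_contra hk
    simp [hk] at h
  · intro hk
    rw [if_pos hk, ← norm_ne_zero_iff, hnorm]
    have : 0 < |stat a (sampleCov Y) k - (σ : ℝ) ^ 2 * D| :=
      abs_pos.2 (by linarith [hin k hk])
    positivity

/-! ### Probability of the exceptional events -/

lemma IsChannel.measureReal_coherence_le {Ω : Type*} [MeasurableSpace Ω] {μ : Measure Ω}
    [IsProbabilityMeasure μ] {D N M : ℕ} {σ : ℝ≥0} {a : Fin N → Ω → EuclideanSpace ℂ (Fin D)}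
    {H : Fin N → Fin M → Ω → ℂ} {Z : Fin D → Fin M → Ω → ℂ} (h : IsChannel μ σ a H Z)
    (hD : 0 < D) (hN : 0 < N) (hlog : Real.log (N * D) ≤ D / 8) :
    μ.real (⋃ p : Fin N × Fin N, {ω | p.1 ≠ p.2 ∧
      8 * D * Real.log (N * D) ≤ ‖inner ℂ (a p.1 ω) (a p.2 ω)‖ ^ 2}) ≤ 4 / (D * √(D : ℝ)) := by
  have hD1 : (1 : ℝ) ≤ D := by exact_mod_cast hD
  have hN1 : (1 : ℝ) ≤ N := by exact_mod_cast hN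
  have hND : (0 : ℝ) < N * D := by positivity
  have hL : 0 ≤ Real.log (N * D) := Real.log_nonneg (one_le_mul_of_one_le_of_one_le hN1 hD1)
  set L := Real.log (N * D) with hLdef
  -- With `τ² = 4 L / D` the cap threshold is `8 D L` and the tail is `4 (N D)⁻⁴`, enough for `N²`
  -- pairs; `τ² ≤ 1 / 2` is the hypothesis `L ≤ D / 8`.
  have hτ : √(4 * L / D) ^ 2 = 4 * L / D := Real.sq_sqrt (by positivity)
  have hpair : ∀ p : Fin N × Fin N, μ.real {ω | p.1 ≠ p.2 ∧
      8 * D * L ≤ ‖inner ℂ (a p.1 ω) (a p.2 ω)‖ ^ 2} ≤ 4 * Real.exp (-(4 * L)) := by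
    rintro ⟨k, l⟩
    by_cases hkl : k = l
    · simp only [hkl, ne_eq, not_true_eq_false, false_and, Set.ofPred_false, measureReal_empty]
      positivity
    have hb := measure_norm_inner_ge_le_of_indepFun hD (h.law_codeword k) (h.law_codeword l)
      (h.indep_codewords.indepFun hkl) (Real.sqrt_nonneg (4 * L / D)) (by
        rw [hτ, div_le_iff₀ (by positivity)]; linarith)
    rw [mul_pow, hτ] at hb
    simp only [ne_eq, hkl, not_false_eq_true, true_and]
    refine ENNReal.toReal_le_of_le_ofReal (by positivity) ?_
    have e1 : 2 * ((D : ℝ) ^ 2 * (4 * L / D)) = 8 * D * L := by field_simp; ring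
    have e2 : (D : ℝ) * (4 * L / D) = 4 * L := by field_simp
    rwa [e1, e2] at hb
  have hexp : Real.exp (-(4 * L)) = ((N * D : ℝ) ^ 4)⁻¹ := by
    rw [Real.exp_neg, hLdef]
    congr 1
    rw [show (4 : ℝ) * Real.log (N * D) = ((4 : ℕ) : ℝ) * Real.log (N * D) by norm_num,
      Real.exp_nat_mul, Real.exp_log hND]
  calc _ ≤ ∑ p : Fin N × Fin N, μ.real {ω | p.1 ≠ p.2 ∧
        8 * D * L ≤ ‖inner ℂ (a p.1 ω) (a p.2 ω)‖ ^ 2} := measureReal_iUnion_fintype_le _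
    _ ≤ ∑ _p : Fin N × Fin N, 4 * Real.exp (-(4 * L)) := Finset.sum_le_sum fun p _ => hpair p
    _ = 4 * (((N : ℝ) ^ 2 * D ^ 4)⁻¹) := by
        rw [hexp]
        simp only [Finset.sum_const, Finset.card_univ, Fintype.card_prod, Fintype.card_fin,
          nsmul_eq_mul, Nat.cast_mul]
        field_simp
    _ ≤ 4 * ((D * √(D : ℝ))⁻¹) := by
        have hs : √(D : ℝ) ≤ D := by
          rw [Real.sqrt_le_left (by positivity)]
          nlinarith
        have hle : (D : ℝ) * √(D : ℝ) ≤ N ^ 2 * D ^ 4 :=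
          calc (D : ℝ) * √(D : ℝ) ≤ D * D := by gcongr
            _ = 1 * D ^ 2 := by ring
            _ ≤ N ^ 2 * D ^ 4 :=
                mul_le_mul (one_le_pow₀ hN1) (pow_le_pow_right₀ hD1 (by norm_num)) (by positivity)
                  (by positivity)
        gcongr
    _ = _ := by rw [div_eq_mul_inv]

lemma IsChannel.measureReal_iUnion_deviationEvent_le {Ω : Type*} [MeasurableSpace Ω]
    {μ : Measure Ω} [IsProbabilityMeasure μ] {D N M : ℕ} {σ : ℝ≥0}
    {a : Fin N → Ω → EuclideanSpace ℂ (Fin D)} {H : Fin N → Fin M → Ω → ℂ}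
    {Z : Fin D → Fin M → Ω → ℂ} (h : IsChannel μ σ a H Z) (γ : Fin N → ℝ)
    {κ C : ℝ} (hκ : 0 < κ) (hC : 0 < C) (hP : IsSubexponential (productLaw κ) C)
    (hE : IsSubexponential (energyLaw κ) C) (hM : 0 < M) (hD : 0 < D)
    (hKD : (supp γ).card ≤ D) {ε : ℝ} (hε0 : 0 < ε) (hε1 : ε < 1)
    (hML : 4 * C * Real.log ((Real.exp 1 * D) ^ 2 / ε) ≤ M) :
    μ.real (⋃ p : (supp γ ⊕ Fin D) × (supp γ ⊕ Fin D), deviationEvent γ σ H Z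
      (2 * √(64 * C * Real.log ((Real.exp 1 * D) ^ 2 / ε) / M) / κ) p.1 p.2) ≤ ε := by
  have hM' : (0 : ℝ) < M := by exact_mod_cast hM
  have hD1 : (1 : ℝ) ≤ D := by exact_mod_cast hD
  have he : (2 : ℝ) ≤ Real.exp 1 := by linarith [Real.add_one_le_exp (1 : ℝ)]
  have hB1 : (1 : ℝ) ≤ (Real.exp 1 * D) ^ 2 := one_le_pow₀ (by nlinarith)
  have hB : 1 ≤ (Real.exp 1 * D) ^ 2 / ε := by
    rw [le_div_iff₀ hε0]; linarith
  have hL : 0 ≤ Real.log ((Real.exp 1 * D) ^ 2 / ε) := Real.log_nonneg hB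
  set L := Real.log ((Real.exp 1 * D) ^ 2 / ε) with hLdef
  -- This deviation makes the Bernstein exponent equal to `-2 L`; the lower bound on `M` is what `x
  -- ≤ 4` requires.
  have hxsq : √(64 * C * L / M) ^ 2 = 64 * C * L / M := Real.sq_sqrt (by positivity)
  have hx4 : √(64 * C * L / M) ≤ 4 := by
    rw [Real.sqrt_le_left (by norm_num), div_le_iff₀ hM']
    linarith
  have hexp : Real.exp (-(M * √(64 * C * L / M) ^ 2 / (32 * C))) =
      (ε / (Real.exp 1 * D) ^ 2) ^ 2 := by
    have e1 : -(M * √(64 * C * L / M) ^ 2 / (32 * C)) = ((2 : ℕ) : ℝ) * -L := by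
      rw [hxsq]
      field_simp
      push_cast
      ring
    rw [e1, Real.exp_nat_mul, Real.exp_neg, hLdef, Real.exp_log (by linarith), inv_div]
  calc _ ≤ ∑ p : (supp γ ⊕ Fin D) × (supp γ ⊕ Fin D), μ.real (deviationEvent γ σ H Z
        (2 * √(64 * C * L / M) / κ) p.1 p.2) := measureReal_iUnion_fintype_le _
    _ ≤ ∑ _p : (supp γ ⊕ Fin D) × (supp γ ⊕ Fin D), 4 * (ε / (Real.exp 1 * D) ^ 2) ^ 2 := by
        rw [← hexp]
        exact Finset.sum_le_sum fun p _ =>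
          h.measureReal_deviationEvent_le γ hκ hP hE (Real.sqrt_nonneg _) hx4 p.1 p.2
    _ = (((supp γ).card + D : ℝ)) ^ 2 * (4 * (ε / (Real.exp 1 * D) ^ 2) ^ 2) := by
        simp only [Finset.sum_const, Finset.card_univ, Fintype.card_prod, Fintype.card_sum,
          Fintype.card_coe, Fintype.card_fin, nsmul_eq_mul]
        push_cast
        ring
    -- From `card ≤ D` and `e ≥ 2`; the bound is then `ε² / D²`.
    _ ≤ (D + D : ℝ) ^ 2 * (4 * (ε / (2 * D) ^ 2) ^ 2) := by
        have : ((supp γ).card : ℝ) ≤ D := by exact_mod_cast hKD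
        gcongr
    _ = ε * (ε / D ^ 2) := by field_simp; ring
    _ ≤ ε * 1 := by
        gcongr
        rw [div_le_one (by positivity)]
        nlinarith
    _ = ε := mul_one _

/-! ### Recovery outside the exceptional events -/

lemma gammaMin_pos {N : ℕ} {γ : Fin N → ℝ} (hγ : ∀ k, 0 ≤ γ k) (hS : (supp γ).Nonempty) :
    0 < gammaMin γ hS := by
  rw [gammaMin, Finset.lt_inf'_iff]
  exact fun k hk => (hγ k).lt_of_ne' (mem_supp.1 hk)

lemma gammaMin_le {N : ℕ} {γ : Fin N → ℝ} (hS : (supp γ).Nonempty) {k : Fin N}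
    (hk : k ∈ supp γ) : gammaMin γ hS ≤ γ k :=
  Finset.inf'_le _ hk

lemma le_gammaMax {N : ℕ} {γ : Fin N → ℝ} (hS : (supp γ).Nonempty) {k : Fin N}
    (hk : k ∈ supp γ) : γ k ≤ gammaMax γ hS :=
  Finset.le_sup' γ hk

/-- Outside two exceptional events, of probabilities at most `ε` and `4 / D ^ (3 / 2)`, both the
largest statistics and one step of iterative hard thresholding recover the support. -/
lemma IsChannel.one_sub_le_measureReal_recovery {Ω : Type*} [MeasurableSpace Ω] {μ : Measure Ω}
    [IsProbabilityMeasure μ] {D N M K : ℕ} {σ : ℝ≥0}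
    {a : Fin N → Ω → EuclideanSpace ℂ (Fin D)} {H : Fin N → Fin M → Ω → ℂ}
    {Z : Fin D → Fin M → Ω → ℂ} (h : IsChannel μ σ a H Z) {γ : Fin N → ℝ} (hγ : ∀ k, 0 ≤ γ k)
    {κ C : ℝ} (hκ : 0 < κ) (hC : 0 < C) (hP : IsSubexponential (productLaw κ) C)
    (hE : IsSubexponential (energyLaw κ) C) (hD : 2 ≤ D) {ε : ℝ} (hε0 : 0 < ε) (hε1 : ε < 1)
    (hS : (supp γ).Nonempty) (hcard : (supp γ).card = K) {cγ : ℝ}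
    (hc : cγ = gammaMax γ hS / gammaMin γ hS)
    (hM : (4 * C + 589824 * C / κ ^ 2) * (cγ * K + (σ : ℝ) ^ 2 / gammaMin γ hS) ^ 2 *
      Real.log ((Real.exp 1 * D) ^ 2 / ε) ≤ M)
    (hK : K * (cγ * Real.log (N * D)) ≤ 1 / 64 * D) {Shat : Ω → Finset (Fin N)}
    (hShat : ∀ ω, IsLargest K (stat (fun k => a k ω) (chanCov γ a H Z ω)) (Shat ω)) :
    1 - ε - 4 / (D * √(D : ℝ)) ≤ μ.real {ω | Shat ω = supp γ ∧ ∀ v : Fin N → ℂ,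
      IsOneStepIHT K σ (fun k => a k ω) (chanCov γ a H Z ω) v → supp v = Shat ω} := by
  have hD0 : 0 < D := by omega
  have hD2 : (2 : ℝ) ≤ D := by exact_mod_cast hD
  have hN : 0 < N := hS.choose.pos
  have hN1 : (1 : ℝ) ≤ N := by exact_mod_cast hN
  have hg := gammaMin_pos hγ hS
  set g := gammaMin γ hS with hgdef
  set G := gammaMax γ hS with hGdef
  have hgG : g ≤ G := by
    obtain ⟨k, hk⟩ := hS
    exact (gammaMin_le _ hk).trans (le_gammaMax _ hk)
  have hG0 : 0 < G := hg.trans_le hgG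
  have hGle : ∀ k, γ k ≤ G := fun k => by
    by_cases hk : k ∈ supp γ
    · exact le_gammaMax hS hk
    · rw [mem_supp, not_not] at hk
      rw [hk]; exact hG0.le
  have hc1 : 1 ≤ cγ := by rw [hc, le_div_iff₀ hg]; linarith
  have hK1 : 1 ≤ K := by rw [← hcard]; exact hS.card_pos
  have hK1' : (1 : ℝ) ≤ K := by exact_mod_cast hK1
  -- Here `D ≥ 2` enters: a logarithm bounded below lets the sparsity condition imply `K ≤ D`.
  have hlog2 : 1 / 2 ≤ Real.log (N * D) := by
    have h2 : (2 : ℝ) ≤ N * D := by nlinarith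
    have := Real.log_le_log (by norm_num) h2
    linarith [Real.log_two_gt_d9]
  set L₁ := Real.log (N * D) with hL₁
  have hcL : L₁ ≤ cγ * L₁ := le_mul_of_one_le_left (by linarith) hc1
  have hKL : K * L₁ ≤ 1 / 64 * D := le_trans (by gcongr) hK
  have hKD : (supp γ).card ≤ D := by
    rw [hcard]
    have : (K : ℝ) ≤ D := by nlinarith
    exact_mod_cast this
  have hlog : L₁ ≤ D / 8 := by
    have : L₁ ≤ K * L₁ := le_mul_of_one_le_left (by linarith) hK1'
    linarith
  have hL0 : 0 < Real.log ((Real.exp 1 * D) ^ 2 / ε) := by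
    have he : (2 : ℝ) ≤ Real.exp 1 := by linarith [Real.add_one_le_exp (1 : ℝ)]
    refine Real.log_pos ?_
    rw [lt_div_iff₀ hε0, one_mul]
    exact hε1.trans_le (one_le_pow₀ (by nlinarith))
  set L := Real.log ((Real.exp 1 * D) ^ 2 / ε) with hLdef
  set B := cγ * K + (σ : ℝ) ^ 2 / g with hB
  have hB1 : 1 ≤ B := by
    have h1 : 1 ≤ cγ * K := one_le_mul_of_one_le_of_one_le hc1 hK1'
    have h2 : 0 ≤ (σ : ℝ) ^ 2 / g := by positivity
    linarith
  have hMpos : (0 : ℝ) < M := lt_of_lt_of_le (by positivity) hM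
  have hMnat : 0 < M := by exact_mod_cast hMpos
  have hML : 4 * C * L ≤ M := by
    refine le_trans ?_ hM
    have h1 : (4 * C) * 1 ≤ (4 * C + 589824 * C / κ ^ 2) * B ^ 2 := by
      gcongr
      · exact le_add_of_nonneg_right (by positivity)
      · exact one_le_pow₀ hB1
    rw [mul_one] at h1
    gcongr
  set η := 2 * √(64 * C * L / M) / κ with hηdef
  have hη0 : 0 ≤ η := by positivity
  have hηB : η * B ≤ 1 / 48 := by
    refine (sq_le_sq₀ (by positivity) (by norm_num)).1 ?_
    rw [hηdef, mul_pow, div_pow, mul_pow, Real.sq_sqrt (by positivity)]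
    have h1 : 589824 * C / κ ^ 2 * B ^ 2 * L ≤ M := by
      refine le_trans ?_ hM
      gcongr
      exact le_add_of_nonneg_left (by positivity)
    -- `589824 = 2² * 64 * 48²`, with `48² = 2304` coming from the target `η B ≤ 1 / 48`.
    have h2 : 2 ^ 2 * (64 * C * L / M) / κ ^ 2 * B ^ 2 =
        (589824 * C / κ ^ 2 * B ^ 2 * L) / M / 2304 := by field_simp; norm_num
    rw [h2]
    have h3 := (div_le_one hMpos).2 h1
    linarith
  have hη : η * (G * (supp γ).card + (σ : ℝ) ^ 2) ≤ g / 48 := by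
    have : G * (supp γ).card + (σ : ℝ) ^ 2 = g * B := by
      rw [hB, hc, hcard]; field_simp
    calc _ = g * (η * B) := by rw [this]; ring
      _ ≤ g * (1 / 48) := by gcongr
      _ = _ := by ring
  have hKG : (supp γ).card * (G * L₁) ≤ 1 / 64 * D * g := by
    have h1 : G = cγ * g := by rw [hc]; field_simp
    calc _ = K * (cγ * L₁) * g := by rw [hcard, h1]; ring
      _ ≤ _ := by gcongr
  have hbad1 := h.measureReal_coherence_le hD0 hN hlog
  have hbad2 := h.measureReal_iUnion_deviationEvent_le γ hκ hC hP hE hMnat hD0 hKD hε0 hε1 hML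
  rw [← hL₁] at hbad1
  rw [← hLdef, ← hηdef] at hbad2
  set bad1 := ⋃ p : Fin N × Fin N, {ω | p.1 ≠ p.2 ∧
      8 * D * L₁ ≤ ‖inner ℂ (a p.1 ω) (a p.2 ω)‖ ^ 2} with hb1
  set bad2 := ⋃ p : (supp γ ⊕ Fin D) × (supp γ ⊕ Fin D), deviationEvent γ σ H Z η p.1 p.2
    with hb2
  have hnorm : ∀ᵐ ω ∂μ, ∀ k, ‖a k ω‖ = √(D : ℝ) := by
    rw [ae_all_iff]
    intro k
    refine ae_of_ae_map (f := a k) (p := fun x => ‖x‖ = √(D : ℝ)) (h.law_codeword k).aemeasurable ?_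
    rw [(h.law_codeword k).map_eq]
    exact ae_norm_sphereUniform D
  set good := {ω | Shat ω = supp γ ∧ ∀ v : Fin N → ℂ,
      IsOneStepIHT K σ (fun k => a k ω) (chanCov γ a H Z ω) v → supp v = Shat ω} with hgood
  -- `Shat` is an arbitrary selection, so `good` need not be measurable; covering the space and
  -- using subadditivity avoids complements.
  have hcover : ∀ᵐ ω ∂μ, ω ∈ (Set.univ : Set Ω) → ω ∈ good ∪ (bad1 ∪ bad2) := by
    filter_upwards [hnorm] with ω hω _
    by_cases h1 : ω ∈ bad1
    · exact Or.inr (Or.inl h1)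
    by_cases h2 : ω ∈ bad2
    · exact Or.inr (Or.inr h2)
    refine Or.inl ?_
    rw [hb1, Set.mem_iUnion, not_exists] at h1
    rw [hb2, Set.mem_iUnion, not_exists] at h2
    have hstat := abs_stat_sub_le hMnat (fun k => a k ω) hγ (fun k j => H k j ω)
      (fun i j => Z i j ω) σ hg hgG hGle (L := L₁) (by linarith) hη0 (hcard ▸ hK1) hω
      (fun k l hkl => le_of_not_ge fun hle => h1 (k, l) ⟨hkl, hle⟩)
      (fun p q => not_lt.1 (h2 (p, q))) hKG hη
    obtain ⟨hT, hI⟩ := supports_eq_of_abs_stat_sub_le hD0 σ hω hg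
      (fun k hk => gammaMin_le hS hk) hcard hstat (hShat ω)
    exact ⟨hT, fun v hv => (hI v hv).trans hT.symm⟩
  have hle : μ.real Set.univ ≤ μ.real (good ∪ (bad1 ∪ bad2)) :=
    ENNReal.toReal_mono (measure_ne_top _ _) (measure_mono_ae hcover)
  have hu := measureReal_union_le (μ := μ) good (bad1 ∪ bad2)
  have hu' := measureReal_union_le (μ := μ) bad1 bad2
  rw [probReal_univ] at hle
  linarith

end URA

theorem theorem3 :
    ∃ c₀ c₄ c₅ : ℝ, 0 < c₀ ∧ 0 < c₄ ∧ 0 < c₅ ∧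
      ∀ (Ω : Type*) [MeasurableSpace Ω] (μ : Measure Ω) [IsProbabilityMeasure μ]
        (D N M K : ℕ) (σ : ℝ≥0) (γ : Fin N → ℝ) (ε : ℝ)
        (a : Fin N → Ω → EuclideanSpace ℂ (Fin D))
        (H : Fin N → Fin M → Ω → ℂ) (Z : Fin D → Fin M → Ω → ℂ),
        0 < D → 0 < ε → (∀ k, 0 ≤ γ k) →
        URA.IsChannel μ σ a H Z →
        ∀ hS : (URA.supp γ).Nonempty, (URA.supp γ).card = K →
        ∀ cγ : ℝ, cγ = URA.gammaMax γ hS / URA.gammaMin γ hS →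
        c₄ * (cγ * K + (σ : ℝ) ^ 2 / URA.gammaMin γ hS) ^ 2 *
          Real.log ((Real.exp 1 * D) ^ 2 / ε) ≤ M →
        -- `K ≤ c₅ D / (cγ log (N D))` with the denominator cleared
        K * (cγ * Real.log (N * D)) ≤ c₅ * D →
        ∀ Shat : Ω → Finset (Fin N),
        (∀ ω, URA.IsLargest K
          (URA.stat (fun k => a k ω) (URA.chanCov γ a H Z ω)) (Shat ω)) →
          1 - ε - c₀ / (D * √(D : ℝ)) ≤ μ.real {ω | Shat ω = URA.supp γ} ∧
          ∀ γ₁ : Ω → Fin N → ℂ,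
          (∀ ω, URA.IsOneStepIHT K σ (fun k => a k ω) (URA.chanCov γ a H Z ω) (γ₁ ω)) →
            1 - ε - c₀ / (D * √(D : ℝ)) ≤
              μ.real {ω | Shat ω = URA.supp γ ∧ URA.supp (γ₁ ω) = Shat ω} := by
  obtain ⟨κ, C, hκ, hC, hP, hE⟩ := URA.exists_isSubexponential
  refine ⟨4, 4 * C + 589824 * C / κ ^ 2, 1 / 64, by norm_num, by positivity, by norm_num, ?_⟩
  intro Ω _ μ _ D N M K σ γ ε a H Z hD hε hγ h hS hcard cγ hc hM hK Shat hShat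
  -- One event handles all thresholding outputs at once, so both conclusions follow by monotonicity.
  have key : 1 - ε - 4 / (D * √(D : ℝ)) ≤ μ.real {ω | Shat ω = URA.supp γ ∧ ∀ v : Fin N → ℂ,
      URA.IsOneStepIHT K σ (fun k => a k ω) (URA.chanCov γ a H Z ω) v →
        URA.supp v = Shat ω} := by
    have h4 : 0 ≤ 4 / (D * √(D : ℝ)) := by positivity
    rcases le_or_gt 1 ε with hε1 | hε1
    · exact le_trans (by linarith) measureReal_nonneg
    rcases Nat.lt_or_ge D 2 with hD2 | hD2
    -- For `D = 1` the claimed bound is `1 - ε - 4 < 0`; this also covers `N D = 1`, where the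
    -- logarithm vanishes.
    · obtain rfl : D = 1 := by omega
      refine le_trans ?_ measureReal_nonneg
      norm_num
      linarith
    exact h.one_sub_le_measureReal_recovery hγ hκ hC hP hE hD2 hε hε1 hS hcard hc hM hK hShat
  exact ⟨key.trans (measureReal_mono fun ω hω => hω.1),
    fun γ₁ hγ₁ => key.trans (measureReal_mono fun ω hω => ⟨hω.1, hω.2 _ (hγ₁ ω)⟩)⟩
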